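/- Let $R$ be a (unital, associative) ring with the discrete topology. Let $P(R^\circ)$ be the category of projective right $R$-modules, and let $P_f(R)$ be the category of finitely generated projective left $R$-modules with its split exact structure. For an exact category $\mathcal C$, let $\mathsf{Lex}(\mathcal C)$ be the category of left exact presheaves of abelian groups on $\mathcal C$, i.e. functors $F\colon\mathcal C^{op}\to\mathsf{Ab}$ such that $0\to F(Z)\to F(Y)\to F(X)$ is exact for each exact sequence $X\hookrightarrow Y\twoheadrightarrow Z$. Let $\mathsf{Ind}^a(\mathcal C)\subset\mathsf{Lex}(\mathcal C)$ be the full subcategory of presheaves isomorphic to $\mathrm{colim}_{i\in I}\hom_{\mathcal C}(-,X_i)$ for a diagram $X\colon I\to\mathcal C$ over a (small) directed poset whose transition maps are admissible monics. Put $\mathsf{Pro}^a(\mathcal C):=\mathsf{Ind}^a(\mathcal C^{op})^{op}$, and let $\mathcal{FM}^\vee(\mathcal C):=\mathsf{Pro}^a(\mathcal C)^{ic}$ be its idempotent completion, in which $\mathcal C$ embeds. For split exact $\mathcal C$, let $P^\vee(\mathcal C)\subset\mathcal{FM}^\vee(\mathcal C)$ be the full subcategory of direct summands of arbitrary (small)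 direct products of objects of $\mathcal C$. Let $\mathsf{Mod}(R)_{top}$ be the category of topological left $R$-modules and continuous homomorphisms. Let $\tau\colon\mathcal{FM}^\vee(P_f(R))\to\mathsf{Mod}(R)_{top}$ be the functor $$\widehat M\mapsto\lim_{(\widehat M\to P),\ P\in P_f(R)}P ,$$ the limit being taken over the category of morphisms from $\widehat M$ to objects $P$ of $P_f(R)$, each $P$ being regarded as a discrete module. For a topological right $R$-module $M$, let $M^\vee$ be the left $R$-module $\hom_{cts}(M,R)$ with the compact-open topology; projective right modules are given the discrete topology. Then the topological dual gives an equivalence of categories $$(-)^\vee\colon P(R^\circ)^{op}\xrightarrow{\ \simeq\ }P^\vee(P_f(R)).$$ Explicitly: the restriction of $\tau$ to $P^\vee(P_f(R))$ is fully faithful, and there is an equivalence $D\colon P(R^\circ)^{op}\to P^\vee(P_f(R))$ such that $\tau\circ D$ is naturally isomorphic to the topological dual functor $M\mapsto M^\vee$ from $P(R^\circ)^{op}$ to $\mathsf{Mod}(R)_{top}$. Consequently, the composite $$P(R^\circ)^{op}\xrightarrow{\ D\ }P^\vee(P_f(R))\hookrightarrow\mathcal{FM}^\vee(P_f(R))$$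 is a fully faithful embedding. -/

import Mathlib

open CategoryTheory CategoryTheory.Limits Opposite

universe v u

noncomputable section

/-! ### Exact categories -/

section ExactCategories

variable {C : Type u} [Category.{v} C] [Preadditive C]

/-- A morphism which is the first map of a sequence in the class `P`. -/
def IsAdmissibleMono (P : ObjectProperty (ShortComplex C)) {X Y : C} (f : X ⟶ Y) : Prop :=
  ∃ (Z : C) (g : Y ⟶ Z) (w : f ≫ g = 0), P (ShortComplex.mk f g w)

/-- A morphism which is the second map of a sequence in the class `P`. -/
def IsAdmissibleEpi (P : ObjectProperty (ShortComplex C)) {Y Z : C} (g : Y ⟶ Z) : Prop :=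
  ∃ (X : C) (f : X ⟶ Y) (w : f ≫ g = 0), P (ShortComplex.mk f g w)

variable (C) in
/-- A (Quillen) exact structure on an additive category: an isomorphism-closed class of
kernel-cokernel pairs, called exact sequences, subject to Quillen's axioms. -/
structure ExactStructure [HasFiniteBiproducts C] where
  /-- The class of exact sequences. -/
  exactSeq : ObjectProperty (ShortComplex C)
  of_iso : ∀ {S T : ShortComplex C}, (S ≅ T) → exactSeq S → exactSeq T
  isKernel : ∀ {S : ShortComplex C}, exactSeq S →
    Nonempty (IsLimit (KernelFork.ofι S.f S.zero))
  isCokernel : ∀ {S : ShortComplex C}, exactSeq S →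
    Nonempty (IsColimit (CokernelCofork.ofπ S.g S.zero))
  id_mono : ∀ X : C, IsAdmissibleMono exactSeq (𝟙 X)
  id_epi : ∀ X : C, IsAdmissibleEpi exactSeq (𝟙 X)
  comp_mono : ∀ {X Y Z : C} (f : X ⟶ Y) (g : Y ⟶ Z), IsAdmissibleMono exactSeq f →
    IsAdmissibleMono exactSeq g → IsAdmissibleMono exactSeq (f ≫ g)
  comp_epi : ∀ {X Y Z : C} (f : X ⟶ Y) (g : Y ⟶ Z), IsAdmissibleEpi exactSeq f →
    IsAdmissibleEpi exactSeq g → IsAdmissibleEpi exactSeq (f ≫ g)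
  pushout_mono : ∀ {X Y X' : C} (f : X ⟶ Y) (a : X ⟶ X'), IsAdmissibleMono exactSeq f →
    ∃ (Y' : C) (b : Y ⟶ Y') (f' : X' ⟶ Y'), IsPushout f a b f' ∧ IsAdmissibleMono exactSeq f'
  pullback_epi : ∀ {Y Z Z' : C} (g : Y ⟶ Z) (a : Z' ⟶ Z), IsAdmissibleEpi exactSeq g →
    ∃ (Y' : C) (b : Y' ⟶ Y) (g' : Y' ⟶ Z'), IsPullback b g' g a ∧ IsAdmissibleEpi exactSeq g'

theorem isAdmissibleMono_op_iff (P : ObjectProperty (ShortComplex C)) {X Y : Cᵒᵖ} (f : X ⟶ Y) :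
    IsAdmissibleMono (fun S : ShortComplex Cᵒᵖ => P S.unop) f ↔ IsAdmissibleEpi P f.unop := by
  constructor
  · rintro ⟨Z, g, w, h⟩
    exact ⟨Z.unop, g.unop, by rw [← unop_comp, w, unop_zero], h⟩
  · rintro ⟨Z, g, w, h⟩
    exact ⟨op Z, g.op, Quiver.Hom.unop_inj (by simpa using w), h⟩

theorem isAdmissibleEpi_op_iff (P : ObjectProperty (ShortComplex C)) {X Y : Cᵒᵖ} (f : X ⟶ Y) :
    IsAdmissibleEpi (fun S : ShortComplex Cᵒᵖ => P S.unop) f ↔ IsAdmissibleMono P f.unop := by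
  constructor
  · rintro ⟨Z, g, w, h⟩
    exact ⟨Z.unop, g.unop, by rw [← unop_comp, w, unop_zero], h⟩
  · rintro ⟨Z, g, w, h⟩
    exact ⟨op Z, g.op, Quiver.Hom.unop_inj (by simpa using w), h⟩

theorem isAdmissibleMono_split_iff {X Y : C} (f : X ⟶ Y) :
    IsAdmissibleMono (fun S : ShortComplex C => Nonempty S.Splitting) f ↔
      ∃ (Z : C) (g : Y ⟶ Z) (r : Y ⟶ X) (s : Z ⟶ Y),
        f ≫ g = 0 ∧ f ≫ r = 𝟙 X ∧ s ≫ g = 𝟙 Z ∧ r ≫ f + g ≫ s = 𝟙 Y := by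
  constructor
  · rintro ⟨Z, g, w, ⟨h⟩⟩
    exact ⟨Z, g, h.r, h.s, w, h.f_r, h.s_g, h.id⟩
  · rintro ⟨Z, g, r, s, w, h1, h2, h3⟩
    exact ⟨Z, g, w, ⟨⟨r, s, h1, h2, h3⟩⟩⟩

theorem isAdmissibleEpi_split_iff {Y Z : C} (g : Y ⟶ Z) :
    IsAdmissibleEpi (fun S : ShortComplex C => Nonempty S.Splitting) g ↔
      ∃ (X : C) (f : X ⟶ Y) (r : Y ⟶ X) (s : Z ⟶ Y),
        f ≫ g = 0 ∧ f ≫ r = 𝟙 X ∧ s ≫ g = 𝟙 Z ∧ r ≫ f + g ≫ s = 𝟙 Y := by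
  constructor
  · rintro ⟨X, f, w, ⟨h⟩⟩
    exact ⟨X, f, h.r, h.s, w, h.f_r, h.s_g, h.id⟩
  · rintro ⟨X, f, r, s, w, h1, h2, h3⟩
    exact ⟨X, f, w, ⟨⟨r, s, h1, h2, h3⟩⟩⟩

variable [HasFiniteBiproducts C]

instance hasFiniteBiproducts_opposite' : HasFiniteBiproducts Cᵒᵖ :=
  HasFiniteBiproducts.of_hasFiniteProducts

/-- The opposite exact structure: a sequence in `Cᵒᵖ` is exact when the opposite sequence in `C`
is. -/
def ExactStructure.opposite (E : ExactStructure C) : ExactStructure Cᵒᵖ where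
  exactSeq := fun S => E.exactSeq S.unop
  of_iso {S T} e h := E.of_iso
    ⟨ShortComplex.unopMap e.inv, ShortComplex.unopMap e.hom,
      by rw [← ShortComplex.unopMap_id, ← e.hom_inv_id]; rfl,
      by rw [← ShortComplex.unopMap_id, ← e.inv_hom_id]; rfl⟩ h
  isKernel {S} h := by
    obtain ⟨hc⟩ := E.isCokernel h
    exact ⟨CokernelCofork.IsColimit.ofπOp S.unop.g S.unop.zero hc⟩
  isCokernel {S} h := by
    obtain ⟨hc⟩ := E.isKernel h
    exact ⟨KernelFork.IsLimit.ofιOp S.unop.f S.unop.zero hc⟩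
  id_mono X := (isAdmissibleMono_op_iff _ _).2 (E.id_epi X.unop)
  id_epi X := (isAdmissibleEpi_op_iff _ _).2 (E.id_mono X.unop)
  comp_mono f g hf hg := by
    rw [isAdmissibleMono_op_iff] at hf hg ⊢
    exact E.comp_epi _ _ hg hf
  comp_epi f g hf hg := by
    rw [isAdmissibleEpi_op_iff] at hf hg ⊢
    exact E.comp_mono _ _ hg hf
  pushout_mono f a hf := by
    rw [isAdmissibleMono_op_iff] at hf
    obtain ⟨Y', b, g', h, h'⟩ := E.pullback_epi f.unop a.unop hf
    exact ⟨op Y', b.op, g'.op, h.op.flip, (isAdmissibleMono_op_iff _ _).2 h'⟩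
  pullback_epi g a hg := by
    rw [isAdmissibleEpi_op_iff] at hg
    obtain ⟨Y', b, g', h, h'⟩ := E.pushout_mono g.unop a.unop hg
    exact ⟨op Y', b.op, g'.op, h.op.flip, (isAdmissibleEpi_op_iff _ _).2 h'⟩

variable (C) in
/-- The split exact structure: the exact sequences are the split ones. -/
def splitExactStructure : ExactStructure C where
  exactSeq := fun S => Nonempty S.Splitting
  of_iso e := fun ⟨h⟩ => ⟨h.ofIso e⟩
  isKernel := fun ⟨h⟩ => by
    have := hasZeroObject_of_hasFiniteBiproducts C
    exact ⟨h.fIsKernel⟩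
  isCokernel := fun ⟨h⟩ => by
    have := hasZeroObject_of_hasFiniteBiproducts C
    exact ⟨h.gIsCokernel⟩
  id_mono X := by
    have := hasZeroObject_of_hasFiniteBiproducts C
    obtain ⟨Z, hZ⟩ := HasZeroObject.zero (C := C)
    exact (isAdmissibleMono_split_iff _).2
      ⟨Z, 0, 𝟙 X, 0, by simp, by simp, hZ.eq_of_src _ _, by simp⟩
  id_epi X := by
    have := hasZeroObject_of_hasFiniteBiproducts C
    obtain ⟨Z, hZ⟩ := HasZeroObject.zero (C := C)
    exact (isAdmissibleEpi_split_iff _).2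
      ⟨Z, 0, 0, 𝟙 X, by simp, hZ.eq_of_src _ _, by simp, by simp⟩
  comp_mono f g hf hg := by
    have := hasBinaryBiproducts_of_finite_biproducts C
    rw [isAdmissibleMono_split_iff] at hf hg ⊢
    obtain ⟨Z₁, g₁, r₁, s₁, a₁, b₁, c₁, d₁⟩ := hf
    obtain ⟨Z₂, g₂, r₂, s₂, a₂, b₂, c₂, d₂⟩ := hg
    have e₂ : s₂ ≫ r₂ = 0 := ShortComplex.Splitting.s_r
      (S := ShortComplex.mk g g₂ a₂) ⟨r₂, s₂, b₂, c₂, d₂⟩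
    refine ⟨Z₁ ⊞ Z₂, biprod.lift (r₂ ≫ g₁) g₂, r₂ ≫ r₁, biprod.desc (s₁ ≫ g) s₂, ?_, ?_, ?_, ?_⟩
    · ext
      · simp [reassoc_of% b₂, a₁]
      · simp [a₂]
    · simp [reassoc_of% b₂, b₁]
    · ext
      · simp [reassoc_of% b₂, c₁]
      · simp [a₂]
      · simp [reassoc_of% e₂]
      · simp [c₂]
    · rw [biprod.lift_desc]
      have h : r₂ ≫ (r₁ ≫ f + g₁ ≫ s₁) ≫ g + g₂ ≫ s₂ = 𝟙 _ := by rw [d₁]; simpa using d₂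
      simpa [add_assoc] using h
  comp_epi f g hf hg := by
    have := hasBinaryBiproducts_of_finite_biproducts C
    rw [isAdmissibleEpi_split_iff] at hf hg ⊢
    obtain ⟨X₁, f₁, r₁, s₁, a₁, b₁, c₁, d₁⟩ := hf
    obtain ⟨X₂, f₂, r₂, s₂, a₂, b₂, c₂, d₂⟩ := hg
    have e₁ : s₁ ≫ r₁ = 0 := ShortComplex.Splitting.s_r
      (S := ShortComplex.mk f₁ f a₁) ⟨r₁, s₁, b₁, c₁, d₁⟩
    refine ⟨X₁ ⊞ X₂, biprod.desc f₁ (f₂ ≫ s₁), biprod.lift r₁ (f ≫ r₂), s₂ ≫ s₁, ?_, ?_, ?_, ?_⟩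
    · ext
      · simp [reassoc_of% a₁]
      · simp [reassoc_of% c₁, a₂]
    · ext
      · simp [b₁]
      · simp [reassoc_of% a₁]
      · simp [e₁]
      · simp [reassoc_of% c₁, b₂]
    · simp [reassoc_of% c₁, c₂]
    · rw [biprod.lift_desc]
      have h : r₁ ≫ f₁ + f ≫ (r₂ ≫ f₂ + g ≫ s₂) ≫ s₁ = 𝟙 _ := by rw [d₂]; simpa using d₁
      simpa [add_assoc] using h
  pushout_mono {X Y X'} f a hf := by
    have := hasBinaryBiproducts_of_finite_biproducts C
    rw [isAdmissibleMono_split_iff] at hf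
    obtain ⟨Z, g, r, s, w, h₁, h₂, h₃⟩ := hf
    have h₄ : s ≫ r = 0 := ShortComplex.Splitting.s_r
      (S := ShortComplex.mk f g w) ⟨r, s, h₁, h₂, h₃⟩
    refine ⟨X' ⊞ Z, biprod.lift (r ≫ a) g, biprod.inl, ⟨⟨?_⟩, ⟨?_⟩⟩, ?_⟩
    · ext
      · simp [reassoc_of% h₁]
      · simp [w]
    · refine PushoutCocone.IsColimit.mk _ (fun t => biprod.desc t.inr (s ≫ t.inl)) ?_ ?_ ?_
      · intro t
        rw [biprod.lift_desc, Category.assoc, ← t.condition, ← Category.assoc, ← Category.assoc,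
          ← Preadditive.add_comp, h₃, Category.id_comp]
      · intro t
        simp
      · intro t m hm₁ hm₂
        ext
        · simp [hm₂]
        · rw [biprod.inr_desc, ← hm₁, ← Category.assoc]
          congr 1
          ext
          · simp [reassoc_of% h₄]
          · simp [h₂]
    · exact (isAdmissibleMono_split_iff _).2 ⟨Z, biprod.snd, biprod.fst, biprod.inr,
        by simp, by simp, by simp, by simp⟩
  pullback_epi {Y Z Z'} g a hg := by
    have := hasBinaryBiproducts_of_finite_biproducts C
    rw [isAdmissibleEpi_split_iff] at hg
    obtain ⟨X, f, r, s, w, h₁, h₂, h₃⟩ := hg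
    have h₄ : s ≫ r = 0 := ShortComplex.Splitting.s_r
      (S := ShortComplex.mk f g w) ⟨r, s, h₁, h₂, h₃⟩
    refine ⟨X ⊞ Z', biprod.desc f (a ≫ s), biprod.snd, ⟨⟨?_⟩, ⟨?_⟩⟩, ?_⟩
    · ext
      · simp [w]
      · simp [h₂]
    · refine PullbackCone.IsLimit.mk _ (fun t => biprod.lift (t.fst ≫ r) t.snd) ?_ ?_ ?_
      · intro t
        rw [biprod.lift_desc, ← Category.assoc t.snd, ← t.condition, Category.assoc,
          Category.assoc, ← Preadditive.comp_add, h₃, Category.comp_id]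
      · intro t
        simp
      · intro t m hm₁ hm₂
        ext
        · rw [biprod.lift_fst, ← hm₁, Category.assoc]
          congr 1
          ext
          · simp [h₁]
          · simp [h₄]
        · simp [hm₂]
    · exact (isAdmissibleEpi_split_iff _).2 ⟨X, biprod.inl, biprod.fst, biprod.inr,
        by simp, by simp, by simp, by simp⟩

end ExactCategories

/-! ### Admissible Ind- and Pro-objects -/

section IndPro

variable {C : Type u} [Category.{v} C] [Preadditive C] [HasFiniteBiproducts C]

/-- A presheaf of abelian groups is left exact if it sends every exact sequence
`X ⟶ Y ⟶ Z` to an exact sequence `0 ⟶ F(Z) ⟶ F(Y) ⟶ F(X)`. -/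
def isLeftExact (E : ExactStructure C) : ObjectProperty (Cᵒᵖ ⥤ AddCommGrpCat.{v}) :=
  fun F => ∀ S : ShortComplex C, E.exactSeq S →
    Function.Injective (F.map S.g.op) ∧ Function.Exact (F.map S.g.op) (F.map S.f.op)

/-- The category of left exact presheaves of abelian groups. -/
abbrev LexCat (E : ExactStructure C) := (isLeftExact E).FullSubcategory

/-- A left exact presheaf is an admissible Ind-object if it is isomorphic to the colimit of the
presheaves represented by an admissible Ind-diagram, that is, by a diagram indexed by a (small)
directed poset all of whose transition maps are admissible monics. Colimits of presheaves are
computed objectwise. -/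
def isAdmissibleInd (E : ExactStructure C) : ObjectProperty (LexCat E) :=
  fun F => ∃ (I : Type v) (_ : PartialOrder I) (_ : IsDirectedOrder I) (_ : Nonempty I)
    (X : I ⥤ C) (c : Cocone (X ⋙ preadditiveYoneda)),
    (∀ ⦃i j : I⦄ (f : i ⟶ j), IsAdmissibleMono E.exactSeq (X.map f)) ∧
      Nonempty (IsColimit c) ∧ Nonempty (c.pt ≅ F.obj)

/-- The category of admissible Ind-objects. -/
abbrev IndA (E : ExactStructure C) := (isAdmissibleInd E).FullSubcategory

/-- The category of admissible Pro-objects. -/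
abbrev ProA (E : ExactStructure C) := (IndA E.opposite)ᵒᵖ

/-- The category of formal duals to flat Mittag-Leffler objects: the idempotent completion of the
category of admissible Pro-objects. -/
abbrev FMDual (E : ExactStructure C) := Idempotents.Karoubi (ProA E)

theorem isLeftExact_yoneda (E : ExactStructure C) (X : C) :
    isLeftExact E (preadditiveYoneda.obj X) := by
  intro S hS
  obtain ⟨hc⟩ := E.isCokernel hS
  refine ⟨fun p q h => ?_, fun p => ⟨fun h => ?_, ?_⟩⟩
  · exact Cofork.IsColimit.hom_ext hc h
  · exact ⟨hc.desc (CokernelCofork.ofπ p h), hc.fac (CokernelCofork.ofπ p h) .one⟩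
  · rintro ⟨q, rfl⟩
    have h : ∀ q : S.X₃ ⟶ X, S.f ≫ S.g ≫ q = 0 := fun q => by
      rw [← Category.assoc, S.zero, zero_comp]
    exact h q

theorem isAdmissibleInd_yoneda (E : ExactStructure C) (X : C) :
    isAdmissibleInd E ⟨preadditiveYoneda.obj X, isLeftExact_yoneda E X⟩ := by
  refine ⟨PUnit, inferInstance, inferInstance, inferInstance, (Functor.const _).obj X,
    ⟨preadditiveYoneda.obj X, { app := fun _ => 𝟙 _ }⟩, fun _ _ _ => E.id_mono X, ⟨?_⟩,
    ⟨Iso.refl _⟩⟩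
  exact
    { desc := fun t => t.ι.app PUnit.unit
      fac := fun t j => Category.id_comp _
      uniq := fun t m hm => (Category.id_comp m).symm.trans (hm PUnit.unit) }

/-- The embedding of an exact category in its category of admissible Ind-objects. -/
def toIndA (E : ExactStructure C) : C ⥤ IndA E :=
  (isAdmissibleInd E).lift ((isLeftExact E).lift preadditiveYoneda (isLeftExact_yoneda E))
    (isAdmissibleInd_yoneda E)

/-- The embedding of an exact category in its category of admissible Pro-objects. -/
def toProA (E : ExactStructure C) : C ⥤ ProA E :=
  (toIndA E.opposite).rightOp

/-- The embedding of an exact category in the idempotent completion of its category of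
admissible Pro-objects. -/
def toFMDual (E : ExactStructure C) : C ⥤ FMDual E :=
  toProA E ⋙ Idempotents.toKaroubi _

/-- `X` is a direct summand of `Z`. -/
def IsDirectSummand {D : Type*} [Category* D] [Preadditive D] (X Z : D) : Prop :=
  ∃ (Y : D) (b : BinaryBicone X Y), Nonempty b.IsBilimit ∧ Nonempty (b.pt ≅ Z)

/-- The direct summands (in the idempotent completion of the category of admissible Pro-objects) of
arbitrary small direct products of objects of `C`. -/
def isFormalDualOfProjective (E : ExactStructure C) : ObjectProperty (FMDual E) :=
  fun X => ∃ (I : Type v) (M : I → C) (c : Fan fun i => (toFMDual E).obj (M i)),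
    Nonempty (IsLimit c) ∧ IsDirectSummand X c.pt

/-- The category of formal duals of projective objects in a (split) exact category. -/
abbrev PDual (E : ExactStructure C) := (isFormalDualOfProjective E).FullSubcategory

/-- The inclusion of formal duals of projective objects in formal duals of flat Mittag-Leffler
objects. -/
abbrev PDual.toFMDual (E : ExactStructure C) : PDual E ⥤ FMDual E :=
  (isFormalDualOfProjective E).ι

theorem locallySmall_karoubi (D : Type*) [Category* D] [LocallySmall.{v} D] :
    LocallySmall.{v} (Idempotents.Karoubi D) where
  hom_small P Q := small_of_injective (f := fun g : P ⟶ Q => g.f)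
    (fun _ _ h => Idempotents.Karoubi.hom_ext _ _ h)

instance locallySmall_FMDual [EssentiallySmall.{v} C] (E : ExactStructure C) :
    LocallySmall.{v} (FMDual E) := by
  have : LocallySmall.{v} (Cᵒᵖᵒᵖ ⥤ AddCommGrpCat.{v}) :=
    (locallySmall_congr ((equivSmallModel.{v} C).op.op.congrLeft)).2 inferInstance
  exact locallySmall_karoubi _

end IndPro

/-! ### Modules -/

section Modules

variable (R : Type u) [Ring R]

/-- Finitely generated projective modules. -/
def isFGProjective : ObjectProperty (ModuleCat.{u} R) :=
  fun M => Module.Finite R M ∧ Module.Projective R M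

/-- The category of finitely generated projective (left) modules. -/
abbrev FGProj := (isFGProjective R).FullSubcategory

instance : (isFGProjective R).IsClosedUnderIsomorphisms where
  of_iso e := fun ⟨_, _⟩ =>
    ⟨Module.Finite.equiv e.toLinearEquiv, Module.Projective.of_equiv e.toLinearEquiv⟩

instance (J : Type) [Finite J] : (isFGProjective R).IsClosedUnderLimitsOfShape (Discrete J) := by
  refine .mk' ?_
  rintro _ ⟨F, hF⟩
  classical
  have := Fintype.ofFinite J
  have h₁ : ∀ j : J, Module.Finite R (F.obj ⟨j⟩) := fun j => (hF ⟨j⟩).1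
  have h₂ : ∀ j : J, Module.Projective R (F.obj ⟨j⟩) := fun j => (hF ⟨j⟩).2
  have e : limit F ≅ ModuleCat.of R (∀ j : J, F.obj ⟨j⟩) :=
    HasLimit.isoOfNatIso Discrete.natIsoFunctor ≪≫
      ModuleCat.piIsoPi (fun j : J => F.obj ⟨j⟩)
  exact (isFGProjective R).prop_of_iso e.symm ⟨Module.Finite.pi,
    Module.Projective.of_equiv (DFinsupp.linearEquivFunOnFintype (R := R))⟩

instance : HasFiniteBiproducts (FGProj R) :=
  have : HasFiniteProducts (FGProj R) := ⟨fun _ => inferInstance⟩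
  HasFiniteBiproducts.of_hasFiniteProducts

instance : EssentiallySmall.{u} (FGProj R) :=
  have h : isFGProjective R ≤ ModuleCat.isFG R := fun _ h => h.1
  essentiallySmall_of_fully_faithful
    (ObjectProperty.ιOfLE h : FGProj R ⥤ FGModuleCat.{u} R)

/-- Projective modules. -/
def isProjectiveModule : ObjectProperty (ModuleCat.{u} R) :=
  fun M => Module.Projective R M

/-- The category of projective modules. -/
abbrev ProjMod := (isProjectiveModule R).FullSubcategory

variable [TopologicalSpace R] [DiscreteTopology R]

/-- A module over a discrete ring, regarded as a topological module with the discrete topology. -/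
def discreteTopModule : ModuleCat.{u} R ⥤ TopModuleCat.{u} R where
  obj M :=
    letI : TopologicalSpace M := ⊥
    haveI : DiscreteTopology M := ⟨rfl⟩
    haveI : ContinuousSMul R M := ⟨continuous_of_discreteTopology⟩
    TopModuleCat.of R M
  map {M N} f :=
    letI : TopologicalSpace M := ⊥
    haveI : DiscreteTopology M := ⟨rfl⟩
    haveI : ContinuousSMul R M := ⟨continuous_of_discreteTopology⟩
    letI : TopologicalSpace N := ⊥
    haveI : DiscreteTopology N := ⟨rfl⟩
    haveI : ContinuousSMul R N := ⟨continuous_of_discreteTopology⟩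
    TopModuleCat.ofHom ⟨f.hom, continuous_of_discreteTopology⟩

variable {R} in
/-- The topological dual of a topological right module: the continuous homomorphisms to the
discrete ring `R`. -/
def TopDual (M : Type u) [AddCommGroup M] [Module Rᵐᵒᵖ M] [TopologicalSpace M] : Type u :=
  M →L[Rᵐᵒᵖ] R

namespace TopDual

section

variable {R}
variable (M : Type u) [AddCommGroup M] [Module Rᵐᵒᵖ M] [TopologicalSpace M]

instance : AddCommGroup (TopDual (R := R) M) :=
  inferInstanceAs (AddCommGroup (M →L[Rᵐᵒᵖ] R))

/-- The left module structure `(r • f) m = r * f m`. -/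
instance : Module R (TopDual (R := R) M) :=
  inferInstanceAs (Module R (M →L[Rᵐᵒᵖ] R))

/-- The inclusion of the topological dual in the module of continuous functions. -/
def toContinuousMap : TopDual (R := R) M →ₗ[R] C(M, R) where
  toFun f := (show M →L[Rᵐᵒᵖ] R from f)
  map_add' _ _ := rfl
  map_smul' _ _ := rfl

/-- The compact-open topology. -/
instance : TopologicalSpace (TopDual (R := R) M) :=
  TopologicalSpace.induced (toContinuousMap M) inferInstance

instance : IsTopologicalAddGroup (TopDual (R := R) M) :=
  topologicalAddGroup_induced (toContinuousMap M)

instance : ContinuousSMul R (TopDual (R := R) M) :=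
  continuousSMul_induced (toContinuousMap (R := R) M)

end

end TopDual

/-- The topological dual, as a contravariant functor from topological right modules to topological
left modules; a morphism acts by precomposition. -/
def topDual : (TopModuleCat.{u} Rᵐᵒᵖ)ᵒᵖ ⥤ TopModuleCat.{u} R where
  obj M := TopModuleCat.of R (TopDual (R := R) M.unop)
  map {M N} f := TopModuleCat.ofHom
    { toFun := fun g => (show M.unop →L[Rᵐᵒᵖ] R from g).comp f.unop.hom
      map_add' := fun _ _ => rfl
      map_smul' := fun _ _ => rfl
      cont := continuous_induced_rng.2 <|
        (ContinuousMap.continuous_precomp (Z := R) ⟨f.unop.hom, f.unop.hom.continuous⟩).comp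
          (continuous_induced_dom (f := TopDual.toContinuousMap (R := R) M.unop)) }

/-- Finitely generated projective modules, regarded as discrete topological modules. -/
def discreteFGProj : FGProj R ⥤ TopModuleCat.{u} R :=
  (isFGProjective R).ι ⋙ discreteTopModule R

/-- The topological dual, as a contravariant functor from projective right modules, regarded as
discrete topological modules, to topological left modules. -/
def projTopDual : (ProjMod Rᵐᵒᵖ)ᵒᵖ ⥤ TopModuleCat.{u} R :=
  ((isProjectiveModule Rᵐᵒᵖ).ι ⋙ discreteTopModule Rᵐᵒᵖ).op ⋙ topDual R

/-- Finitely generated projective modules with their usual exact sequences, all of which split. -/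
abbrev exactFGProj : ExactStructure (FGProj R) := splitExactStructure (FGProj R)

instance hasPointwiseRightKanExtension_toFMDual :
    (toFMDual (exactFGProj R)).HasPointwiseRightKanExtension (discreteFGProj R) := fun X => by
  have : HasLimitsOfShape (StructuredArrow X (toFMDual (exactFGProj R))) (TopModuleCat.{u} R) :=
    hasLimitsOfShape_of_essentiallySmall.{u} _ _
  infer_instance

/-- The functor `τ` from formal duals of flat Mittag-Leffler modules to topological modules: it
sends `X` to the limit, over the category of morphisms from `X` to finitely generated projective
modules `P`, of the discrete modules `P`. -/
def proToTop : FMDual (exactFGProj R) ⥤ TopModuleCat.{u} R :=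
  (toFMDual (exactFGProj R)).pointwiseRightKanExtension (discreteFGProj R)

end Modules
end

/-! The argument runs through characters: for every object $X$ of $\mathcal{FM}^\vee(P_f(R))$ the
group $\hom(X,R)$ is a right $R$-module, because right multiplications act on the left module $R$.
Since $P_f(R)$ is essentially small, this module has a copy `FMDual.Char X` in the universe of $R$.
Three facts combine.

First, $\tau(X)\cong\hom(X,R)^\vee$ for every $X$ (`proToTopIso`). A finitely generated projective
$P$ has a finite dual basis, so a compatible family of elements of $P$, indexed by the morphisms
$X\to P$, is determined by its components at the morphisms $X\to R$. Compatibility with right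
multiplications and with the maps out of $R\times R$ makes these components a linear form on
$\hom(X,R)$. The topologies agree because the compact-open topology on the dual of a discrete module
is that of pointwise convergence.

Second, $\hom(-,R)$ is an equivalence from $P^\vee(P_f(R))$ to the opposite of the category of
projective right modules (`PDual.charFunctor`). The product $R^I$ is represented by the presheaf
$P\mapsto P^{(I)}$, and by Yoneda its characters are free on the projections (`FMDual.freeBasis`).
Every object of $P^\vee(P_f(R))$ is a retract of some $R^I$, which gives full faithfulness;
splitting idempotents gives essential surjectivity.

Third, the topological dual is fully faithful on projective right modules, because these are
reflexive: a continuous form on $N^\vee$ depends on finitely many evaluations, hence is itself an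
evaluation (`TopDual.exists_eq_eval`).

So $\tau$ restricted to $P^\vee(P_f(R))$ is an equivalence followed by a fully faithful functor, and
$D$ is the inverse of that equivalence. -/

noncomputable section

/-! ### Faithfulness and additivity of the embeddings -/

section Embedding

variable {C : Type u} [Category.{v} C] [Preadditive C] [HasFiniteBiproducts C]
variable (E : ExactStructure C)

instance : (toIndA E).Faithful := by unfold toIndA; infer_instance

instance : (toIndA E).Additive where
  map_add {X Y f g} := by
    apply ObjectProperty.hom_ext
    apply ObjectProperty.hom_ext
    ext A (a : A.unop ⟶ X)
    exact Preadditive.comp_add _ _ _ a f g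

instance : (toProA E).Faithful := by unfold toProA; infer_instance

instance : (toProA E).Additive where
  map_add {X Y f g} := by
    change ((toIndA E.opposite).map (f + g).op).op = _
    rw [op_add, Functor.map_add, op_add]
    rfl

instance : (toFMDual E).Faithful := by unfold toFMDual; infer_instance

instance : (toFMDual E).Additive := by unfold toFMDual; infer_instance

end Embedding

/-! ### Finite dual bases -/

section FG
variable {R : Type u} [Ring R]

theorem Module.exists_finite_dual_basis (P : Type*) [AddCommGroup P] [Module R P]
    [Module.Finite R P] [Module.Projective R P] :
    ∃ (n : ℕ) (b : Fin n → P) (l : Fin n → P →ₗ[R] R), ∀ x, ∑ k, l k x • b k = x := by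
  obtain ⟨n, f, g, -, -, h⟩ := Module.Finite.exists_comp_eq_id_of_projective R P
  refine ⟨n, fun k => f (Pi.single k 1), fun k => LinearMap.proj k ∘ₗ g, fun x => ?_⟩
  have := LinearMap.congr_fun h x
  simp only [LinearMap.coe_comp, Function.comp_apply, LinearMap.id_coe, id_eq] at this
  conv_rhs => rw [← this]
  rw [LinearMap.pi_apply_eq_sum_univ f]
  congr! with k
  simp [Pi.single_apply, eq_comm]

end FG

/-! ### The right module of characters -/

section ContinuousCharacters

variable (R : Type u) [Ring R]

/-- The ring as a finitely generated projective left module over itself. -/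
def FGProj.self : FGProj R := ⟨ModuleCat.of R R, inferInstance, inferInstance⟩

variable {R} in
/-- A linear map as a morphism of finitely generated projective modules. -/
def FGProj.ofHom {P Q : FGProj R} (f : P.obj →ₗ[R] Q.obj) : P ⟶ Q :=
  ObjectProperty.homMk (ModuleCat.ofHom f)

variable {R} in
/-- A linear form as a morphism of finitely generated projective modules. -/
def FGProj.form {P : FGProj R} (l : P.obj →ₗ[R] R) : P ⟶ FGProj.self R :=
  FGProj.ofHom (Q := FGProj.self R) l

variable {R} in
/-- An element as a morphism of finitely generated projective modules. -/
def FGProj.elt {P : FGProj R} (x : P.obj) : FGProj.self R ⟶ P :=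
  FGProj.ofHom (P := FGProj.self R) (LinearMap.toSpanSingleton R P.obj x)

variable {R} in
/-- Right multiplication. -/
def FGProj.rightMul (r : Rᵐᵒᵖ) : FGProj.self R ⟶ FGProj.self R :=
  FGProj.form (P := FGProj.self R) (LinearMap.toSpanSingleton R R r.unop)

variable {R}

theorem FGProj.hom_ext {P Q : FGProj R} {f g : P ⟶ Q} (h : ∀ x, f.hom.hom x = g.hom.hom x) :
    f = g := by
  apply ObjectProperty.hom_ext
  ext x
  exact h x

theorem FGProj.rightMul_one : FGProj.rightMul (1 : Rᵐᵒᵖ) = 𝟙 _ :=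
  FGProj.hom_ext fun (x : R) => mul_one x

theorem FGProj.rightMul_zero : FGProj.rightMul (0 : Rᵐᵒᵖ) = 0 :=
  FGProj.hom_ext fun (x : R) => mul_zero x

theorem FGProj.rightMul_mul (r s : Rᵐᵒᵖ) :
    FGProj.rightMul (r * s) = FGProj.rightMul s ≫ FGProj.rightMul r :=
  FGProj.hom_ext fun (x : R) => (mul_assoc x s.unop r.unop).symm

theorem FGProj.rightMul_add (r s : Rᵐᵒᵖ) :
    FGProj.rightMul (r + s) = FGProj.rightMul r + FGProj.rightMul s :=
  FGProj.hom_ext fun (x : R) => mul_add x r.unop s.unop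

/-- The image of the ring in the formal duals of flat Mittag-Leffler modules. -/
abbrev FMDual.self (R : Type u) [Ring R] : FMDual (splitExactStructure (FGProj R)) :=
  (toFMDual (splitExactStructure (FGProj R))).obj (FGProj.self R)

variable {X Y : FMDual (splitExactStructure (FGProj R))}

/-- The endomorphisms of the left module $R$ are the right multiplications, and composing them is
multiplication in `Rᵐᵒᵖ`. -/
instance instModuleFMDualHom : Module Rᵐᵒᵖ (X ⟶ FMDual.self R) where
  smul r f := f ≫ (toFMDual _).map (FGProj.rightMul r)
  one_smul f := by
    change f ≫ _ = f
    rw [FGProj.rightMul_one, CategoryTheory.Functor.map_id, Category.comp_id]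
  mul_smul r s f := by
    change f ≫ _ = (f ≫ _) ≫ _
    rw [FGProj.rightMul_mul, Functor.map_comp, Category.assoc]
  smul_zero r := zero_comp
  smul_add r f g := Preadditive.add_comp _ _ _ _ _ _
  add_smul r s f := by
    change f ≫ _ = f ≫ _ + f ≫ _
    rw [FGProj.rightMul_add, Functor.map_add, Preadditive.comp_add]
  zero_smul f := by
    change f ≫ _ = 0
    rw [FGProj.rightMul_zero, Functor.map_zero, comp_zero]

theorem FMDual.smul_def (r : Rᵐᵒᵖ) (f : X ⟶ FMDual.self R) :
    r • f = f ≫ (toFMDual _).map (FGProj.rightMul r) := rfl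

/-- Precomposition, as a homomorphism of right modules. -/
def FMDual.precomp (f : X ⟶ Y) : (Y ⟶ FMDual.self R) →ₗ[Rᵐᵒᵖ] (X ⟶ FMDual.self R) where
  toFun g := f ≫ g
  map_add' _ _ := Preadditive.comp_add _ _ _ _ _ _
  map_smul' _ _ := (Category.assoc _ _ _).symm

/-- A small model for the right module of morphisms to the ring. -/
abbrev FMDual.Char (X : FMDual (splitExactStructure (FGProj R))) : Type u :=
  Shrink.{u} (X ⟶ FMDual.self R)

/-- The small model is isomorphic to the module of morphisms to the ring. -/
def FMDual.charEquiv (X : FMDual (splitExactStructure (FGProj R))) :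
    FMDual.Char X ≃ₗ[Rᵐᵒᵖ] (X ⟶ FMDual.self R) :=
  Shrink.linearEquiv Rᵐᵒᵖ _

variable (R) in
/-- The functor sending `X` to the right module of morphisms from `X` to the ring. -/
def FMDual.charFunctor :
    FMDual (splitExactStructure (FGProj R)) ⥤ (ModuleCat.{u} Rᵐᵒᵖ)ᵒᵖ where
  obj X := op (ModuleCat.of Rᵐᵒᵖ (FMDual.Char X))
  map {X Y} f := (ModuleCat.ofHom ((FMDual.charEquiv X).symm.toLinearMap ∘ₗ
    FMDual.precomp f ∘ₗ (FMDual.charEquiv Y).toLinearMap)).op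
  map_id X := by
    apply Quiver.Hom.unop_inj
    ext x
    simp [FMDual.precomp]
  map_comp f g := by
    apply Quiver.Hom.unop_inj
    ext x
    simp [FMDual.precomp]

@[simp]
theorem FMDual.charEquiv_charFunctor_map (f : X ⟶ Y) (a : FMDual.Char Y) :
    FMDual.charEquiv X (((FMDual.charFunctor R).map f).unop.hom a) = f ≫ FMDual.charEquiv Y a :=
  (FMDual.charEquiv X).apply_symm_apply _

theorem FMDual.charFunctor_map_symm (f : X ⟶ Y) (a : Y ⟶ FMDual.self R) :
    ((FMDual.charFunctor R).map f).unop.hom ((FMDual.charEquiv Y).symm a) =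
      (FMDual.charEquiv X).symm (f ≫ a) := by
  apply (FMDual.charEquiv X).injective
  rw [FMDual.charEquiv_charFunctor_map]
  simp

end ContinuousCharacters

/-! ### From linear forms on characters to elements of finitely generated projectives -/

section Kan

variable {R : Type u} [Ring R]

theorem FGProj.form_elt {P : FGProj R} (l : P.obj →ₗ[R] R) (x : R) :
    FGProj.form l ≫ FGProj.rightMul (.op x) = FGProj.form (l.smulRight x) :=
  FGProj.hom_ext fun _ => rfl

theorem FGProj.ofHom_form {P Q : FGProj R} (f : P ⟶ Q) (l : Q.obj →ₗ[R] R) :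
    f ≫ FGProj.form l = FGProj.form (l ∘ₗ f.hom.hom) :=
  FGProj.hom_ext fun _ => rfl

theorem FGProj.exists_dual_basis (P : FGProj R) :
    ∃ (n : ℕ) (b : Fin n → P.obj) (l : Fin n → P.obj →ₗ[R] R), ∀ x, ∑ k, l k x • b k = x :=
  have : Module.Finite R P.obj := P.property.1
  have : Module.Projective R P.obj := P.property.2
  Module.exists_finite_dual_basis P.obj

/-- The number of elements of a chosen finite dual basis. -/
def FGProj.rank (P : FGProj R) : ℕ :=
  P.exists_dual_basis.choose

/-- The elements of a chosen finite dual basis. -/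
def FGProj.gen (P : FGProj R) : Fin P.rank → P.obj :=
  P.exists_dual_basis.choose_spec.choose

/-- The linear forms of a chosen finite dual basis. -/
def FGProj.coord (P : FGProj R) : Fin P.rank → P.obj →ₗ[R] R :=
  P.exists_dual_basis.choose_spec.choose_spec.choose

theorem FGProj.sum_coord_smul_gen (P : FGProj R) (x : P.obj) :
    ∑ k, P.coord k x • P.gen k = x :=
  P.exists_dual_basis.choose_spec.choose_spec.choose_spec x

/-- The coordinates of a dual basis already separate elements. Identities between elements of $P$
thereby reduce to identities in $R$. -/
theorem FGProj.eq_of_forms {P : FGProj R} {x y : P.obj}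
    (h : ∀ l : P.obj →ₗ[R] R, l x = l y) : x = y := by
  rw [← P.sum_coord_smul_gen x, ← P.sum_coord_smul_gen y]
  simp only [h]

theorem FGProj.form_eq_sum {P : FGProj R} (l : P.obj →ₗ[R] R) :
    FGProj.form l = ∑ k, FGProj.form (P.coord k) ≫ FGProj.rightMul (.op (l (P.gen k))) := by
  simp only [FGProj.form_elt]
  let φ : (P.obj →ₗ[R] R) →+ (P ⟶ FGProj.self R) :=
    { toFun := FGProj.form, map_zero' := rfl, map_add' := fun _ _ => rfl }
  change φ l = ∑ k, φ _
  rw [← map_sum]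
  congr 1
  ext x
  conv_lhs => rw [← P.sum_coord_smul_gen x]
  simp

variable {X Y : FMDual (splitExactStructure (FGProj R))}

/-- The element of `P` given by evaluating a linear form on characters along `X ⟶ P`. -/
def FMDual.evalAt {P : FGProj R} (a : X ⟶ (toFMDual _).obj P) (h : FMDual.Char X →ₗ[Rᵐᵒᵖ] R) :
    P.obj :=
  ∑ k, h ((FMDual.charEquiv X).symm (a ≫ (toFMDual _).map (FGProj.form (P.coord k)))) • P.gen k

/-- Every form on $P$ is a right combination of the coordinate forms, and $h$ is right linear. This
characterises `FMDual.evalAt` independently of the chosen dual basis, and its naturality and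
additivity are deduced from here. -/
theorem FMDual.form_evalAt {P : FGProj R} (a : X ⟶ (toFMDual _).obj P)
    (h : FMDual.Char X →ₗ[Rᵐᵒᵖ] R) (l : P.obj →ₗ[R] R) :
    l (FMDual.evalAt a h) =
      h ((FMDual.charEquiv X).symm (a ≫ (toFMDual _).map (FGProj.form l))) := by
  rw [FGProj.form_eq_sum l, Functor.map_sum, Preadditive.comp_sum, map_sum, map_sum,
    FMDual.evalAt, map_sum]
  refine Finset.sum_congr rfl fun k _ => ?_
  rw [Functor.map_comp, ← Category.assoc, ← FMDual.smul_def, map_smul, map_smul, map_smul]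
  rfl

theorem FMDual.evalAt_comp_right {P Q : FGProj R} (a : X ⟶ (toFMDual _).obj P) (f : P ⟶ Q)
    (h : FMDual.Char X →ₗ[Rᵐᵒᵖ] R) :
    FMDual.evalAt (a ≫ (toFMDual _).map f) h = f.hom.hom (FMDual.evalAt a h) :=
  FGProj.eq_of_forms fun l => by
    rw [FMDual.form_evalAt, Category.assoc, ← Functor.map_comp, FGProj.ofHom_form,
      ← FMDual.form_evalAt]
    rfl

theorem FMDual.evalAt_self (a : X ⟶ FMDual.self R) (h : FMDual.Char X →ₗ[Rᵐᵒᵖ] R) :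
    FMDual.evalAt a h = h ((FMDual.charEquiv X).symm a) := by
  have e := FMDual.form_evalAt (P := FGProj.self R) a h LinearMap.id
  have e' : FGProj.form (P := FGProj.self R) LinearMap.id = 𝟙 _ := rfl
  rwa [e', CategoryTheory.Functor.map_id, Category.comp_id] at e

variable [TopologicalSpace R] [DiscreteTopology R]

variable (R) in
/-- The topological dual of the right module of characters. -/
def FMDual.charDual : FMDual (exactFGProj R) ⥤ TopModuleCat.{u} R :=
  FMDual.charFunctor R ⋙ (discreteTopModule Rᵐᵒᵖ).op ⋙ topDual R

/-- The linear form underlying an element of the topological dual. -/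
def FMDual.toForm (h : (FMDual.charDual R).obj X) : FMDual.Char X →ₗ[Rᵐᵒᵖ] R :=
  letI : TopologicalSpace (FMDual.Char X) := ⊥
  (show FMDual.Char X →L[Rᵐᵒᵖ] R from h).toLinearMap

/-- Any linear form on a discrete module is continuous. -/
def FMDual.ofForm (h : FMDual.Char X →ₗ[Rᵐᵒᵖ] R) : (FMDual.charDual R).obj X :=
  letI : TopologicalSpace (FMDual.Char X) := ⊥
  haveI : DiscreteTopology (FMDual.Char X) := ⟨rfl⟩
  show FMDual.Char X →L[Rᵐᵒᵖ] R from ⟨h, continuous_of_discreteTopology⟩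

theorem FMDual.ofForm_toForm (h : (FMDual.charDual R).obj X) :
    FMDual.ofForm (FMDual.toForm h) = h := rfl

theorem FMDual.toForm_injective {g h : (FMDual.charDual R).obj X}
    (e : FMDual.toForm g = FMDual.toForm h) : g = h := by
  rw [← FMDual.ofForm_toForm g, e, FMDual.ofForm_toForm]

theorem FMDual.toForm_map (f : X ⟶ Y) (h : (FMDual.charDual R).obj X) (a : FMDual.Char Y) :
    FMDual.toForm (((FMDual.charDual R).map f).hom h) a =
      FMDual.toForm h (((FMDual.charFunctor R).map f).unop.hom a) := rfl

end Kan

/-! ### The compact-open topology on the dual of a discrete module -/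

section TopDual
variable {R : Type u} [Ring R] [TopologicalSpace R] [DiscreteTopology R]
variable {M : Type u} [AddCommGroup M] [Module Rᵐᵒᵖ M] [TopologicalSpace M]

/-- Evaluation is continuous in the compact-open topology -/
theorem TopDual.continuous_eval (m : M) :
    Continuous fun f : TopDual (R := R) M => (show M →L[Rᵐᵒᵖ] R from f) m := by
  have : Continuous fun f : TopDual (R := R) M => TopDual.toContinuousMap M f m :=
    (continuous_eval_const m).comp continuous_induced_dom
  exact this

/-- On a discrete module the compact-open topology is the topology of pointwise convergence. -/
theorem TopDual.continuous_of_eval (hM : DiscreteTopology M) {S : Type*} [TopologicalSpace S]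
    (f : S → TopDual (R := R) M)
    (hf : ∀ m : M, Continuous fun s => (show M →L[Rᵐᵒᵖ] R from f s) m) : Continuous f := by
  refine continuous_induced_rng.2 ?_
  refine (ContinuousMap.isHomeomorph_coe.isEmbedding).continuous_iff.2 ?_
  exact continuous_pi hf

end TopDual

/-! ### The dual of the characters as a pointwise right Kan extension -/

section Kan

variable {R : Type u} [Ring R] [TopologicalSpace R] [DiscreteTopology R]
variable {X Y : FMDual (splitExactStructure (FGProj R))}

theorem FMDual.continuous_toForm (a : FMDual.Char X) :
    Continuous fun h : (FMDual.charDual R).obj X => FMDual.toForm h a :=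
  letI : TopologicalSpace (FMDual.Char X) := ⊥
  TopDual.continuous_eval (M := FMDual.Char X) a

theorem FMDual.continuous_of_toForm {S : Type*} [TopologicalSpace S]
    (f : S → (FMDual.charDual R).obj X)
    (hf : ∀ a : FMDual.Char X, Continuous fun s => FMDual.toForm (f s) a) : Continuous f :=
  letI : TopologicalSpace (FMDual.Char X) := ⊥
  TopDual.continuous_of_eval (M := FMDual.Char X) (DiscreteTopology.mk rfl) f hf

instance (P : FGProj R) : DiscreteTopology ((discreteFGProj R).obj P) := ⟨rfl⟩

/-- Evaluation of a linear form at a morphism to a finitely generated projective module. -/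
def FMDual.evalHom {P : FGProj R} (a : X ⟶ (toFMDual _).obj P) :
    (FMDual.charDual R).obj X ⟶ (discreteFGProj R).obj P :=
  ConcreteCategory.ofHom (X := (FMDual.charDual R).obj X) (Y := (discreteFGProj R).obj P)
    { toFun := fun h => FMDual.evalAt a (FMDual.toForm h)
      map_add' := fun g h => FGProj.eq_of_forms fun l => by
        erw [l.map_add]
        rw [FMDual.form_evalAt, FMDual.form_evalAt, FMDual.form_evalAt]
        rfl
      map_smul' := fun r h => FGProj.eq_of_forms fun l => by
        erw [l.map_smul]
        rw [FMDual.form_evalAt, FMDual.form_evalAt]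
        rfl
      cont := by
        -- The value depends only on the finitely many numbers that the form takes at the coordinate
        -- characters, and a finite power of $R$ is discrete.
        have h : Continuous (fun c : Fin P.rank → R => ∑ k, c k • P.gen k :
            _ → (discreteFGProj R).obj P) :=
          continuous_of_discreteTopology
        exact h.comp (continuous_pi fun k => FMDual.continuous_toForm _) }

theorem FMDual.charDual_map_evalHom {P : FGProj R} (f : X ⟶ Y) (a : Y ⟶ (toFMDual _).obj P) :
    (FMDual.charDual R).map f ≫ FMDual.evalHom a = FMDual.evalHom (f ≫ a) := by
  ext h
  change FMDual.evalAt _ _ = FMDual.evalAt _ _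
  refine FGProj.eq_of_forms fun l => ?_
  rw [FMDual.form_evalAt, FMDual.form_evalAt]
  erw [FMDual.toForm_map]
  rw [FMDual.charFunctor_map_symm, Category.assoc]

variable (R) in
/-- The restriction of `FMDual.charDual` to finitely generated projective modules. -/
def FMDual.charDualCounit :
    toFMDual (exactFGProj R) ⋙ FMDual.charDual R ⟶ discreteFGProj R where
  app P := FMDual.evalHom (𝟙 _)
  naturality P Q f := by
    rw [Functor.comp_map, FMDual.charDual_map_evalHom, Category.comp_id]
    ext h
    change FMDual.evalAt _ _ = f.hom.hom (FMDual.evalAt _ _)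
    rw [← FMDual.evalAt_comp_right, Category.id_comp]

section Cone

variable (s : Cone (StructuredArrow.proj X (toFMDual (exactFGProj R)) ⋙ discreteFGProj R))

/-- The component of a cone at a morphism. -/
def FMDual.component (x : s.pt) {P : FGProj R} (a : X ⟶ (toFMDual (exactFGProj R)).obj P) :
    P.obj :=
  (s.π.app (StructuredArrow.mk a)).hom x

theorem FMDual.component_comp (x : s.pt) {P Q : FGProj R}
    (a : X ⟶ (toFMDual (exactFGProj R)).obj P) (f : P ⟶ Q) :
    FMDual.component s x (a ≫ (toFMDual (exactFGProj R)).map f) =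
      f.hom.hom (FMDual.component s x a) := by
  have h := s.w (StructuredArrow.homMk f : StructuredArrow.mk a ⟶
    StructuredArrow.mk (a ≫ (toFMDual (exactFGProj R)).map f))
  exact (congr_arg (fun g => g.hom x) h).symm

/-- A cone is only required to be compatible with morphisms under $X$. Additivity comes from pairing
$a$ and $b$ to a morphism $X\to R\times R$ and comparing the two projections with their sum. -/
theorem FMDual.component_add (x : s.pt) (a b : X ⟶ FMDual.self R) :
    FMDual.component s x (a + b) = (FMDual.component s x a + FMDual.component s x b : R) := by
  let Q : FGProj R := ⟨ModuleCat.of R (R × R), inferInstance, inferInstance⟩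
  let i₁ : FGProj.self R ⟶ Q := FGProj.ofHom (Q := Q) (LinearMap.inl R R R)
  let i₂ : FGProj.self R ⟶ Q := FGProj.ofHom (Q := Q) (LinearMap.inr R R R)
  let p₁ : Q ⟶ FGProj.self R := FGProj.form (P := Q) (LinearMap.fst R R R)
  let p₂ : Q ⟶ FGProj.self R := FGProj.form (P := Q) (LinearMap.snd R R R)
  have h₁₁ : i₁ ≫ p₁ = 𝟙 _ := rfl
  have h₁₂ : i₁ ≫ p₂ = 0 := rfl
  have h₂₁ : i₂ ≫ p₁ = 0 := rfl
  have h₂₂ : i₂ ≫ p₂ = 𝟙 _ := rfl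
  let J := toFMDual (exactFGProj R)
  let c : X ⟶ J.obj Q := a ≫ J.map i₁ + b ≫ J.map i₂
  have e₁ : c ≫ J.map p₁ = a := by
    simp only [c, Preadditive.add_comp, Category.assoc, ← Functor.map_comp, h₁₁, h₂₁,
      CategoryTheory.Functor.map_id, Functor.map_zero, comp_zero, add_zero]
    exact Category.comp_id a
  have e₂ : c ≫ J.map p₂ = b := by
    simp only [c, Preadditive.add_comp, Category.assoc, ← Functor.map_comp, h₁₂, h₂₂,
      CategoryTheory.Functor.map_id, Functor.map_zero, comp_zero, zero_add]
    exact Category.comp_id b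
  have e : a + b = c ≫ J.map (p₁ + p₂) := by
    rw [Functor.map_add, Preadditive.comp_add, e₁, e₂]
  rw [e, FMDual.component_comp]
  conv_rhs => rw [← e₁, ← e₂, FMDual.component_comp, FMDual.component_comp]
  rfl

/-- The linear form assembled from a compatible family of elements. -/
def FMDual.formOfCone (x : s.pt) : FMDual.Char X →ₗ[Rᵐᵒᵖ] R where
  toFun a := FMDual.component s x (FMDual.charEquiv X a)
  map_add' a b := by
    rw [map_add]
    exact FMDual.component_add s x _ _
  map_smul' r a := by
    rw [map_smul, FMDual.smul_def]
    exact FMDual.component_comp s x _ _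

theorem FMDual.formOfCone_symm (x : s.pt) (a : X ⟶ FMDual.self R) :
    FMDual.formOfCone s x ((FMDual.charEquiv X).symm a) = FMDual.component s x a :=
  congr_arg (FMDual.component s x) ((FMDual.charEquiv X).apply_symm_apply a)

theorem FMDual.evalAt_formOfCone (x : s.pt) {P : FGProj R}
    (a : X ⟶ (toFMDual (exactFGProj R)).obj P) :
    FMDual.evalAt a (FMDual.formOfCone s x) = FMDual.component s x a :=
  FGProj.eq_of_forms fun l => by
    rw [FMDual.form_evalAt, FMDual.formOfCone_symm, FMDual.component_comp]
    rfl

/-- The universal morphism from a cone to the topological dual of the module of characters. -/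
def FMDual.coneLift : s.pt ⟶ (FMDual.charDual R).obj X :=
  ConcreteCategory.ofHom (X := s.pt) (Y := (FMDual.charDual R).obj X)
    { toFun := fun x => FMDual.ofForm (FMDual.formOfCone s x)
      map_add' := fun x y => FMDual.toForm_injective (LinearMap.ext fun a =>
        map_add (s.π.app (StructuredArrow.mk (FMDual.charEquiv X a))).hom x y)
      map_smul' := fun r x => FMDual.toForm_injective (LinearMap.ext fun a =>
        map_smul (s.π.app (StructuredArrow.mk (FMDual.charEquiv X a))).hom r x)
      cont := FMDual.continuous_of_toForm _ fun a => by
        -- The source carries the topology `⊥` and the target the given topology of $R$; as the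
        -- source is discrete, the identity between them is continuous.
        have h : @Continuous ((discreteFGProj R).obj (FGProj.self R)) R _ _ (fun x => x) :=
          continuous_of_discreteTopology
        have h' : @Continuous s.pt R _ _ fun x => FMDual.component s x (FMDual.charEquiv X a) :=
          h.comp (s.π.app (StructuredArrow.mk (FMDual.charEquiv X a))).hom.continuous
        exact h' }

theorem FMDual.coneLift_evalHom {P : FGProj R} (a : X ⟶ (toFMDual (exactFGProj R)).obj P) :
    FMDual.coneLift s ≫ FMDual.evalHom a = s.π.app (StructuredArrow.mk a) := by
  ext x
  exact FMDual.evalAt_formOfCone s x a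

end Cone

variable (R) in
/-- The functor `FMDual.charDual` is a pointwise right Kan extension. -/
def FMDual.charDualIsPointwise :
    (Functor.RightExtension.mk _ (FMDual.charDualCounit R)).IsPointwiseRightKanExtension :=
  fun X =>
  have key (f : StructuredArrow X (toFMDual (exactFGProj R))) :
      ((Functor.RightExtension.mk _ (FMDual.charDualCounit R)).coneAt X).π.app f =
        FMDual.evalHom f.hom :=
    (FMDual.charDual_map_evalHom f.hom (𝟙 _)).trans (by rw [Category.comp_id])
  { lift := fun s => FMDual.coneLift s
    fac := fun s f => by
      rw [key]
      exact FMDual.coneLift_evalHom s f.hom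
    uniq := fun s m hm => by
      ext x
      refine FMDual.toForm_injective (LinearMap.ext fun a => ?_)
      -- For uniqueness the legs at morphisms $X\to R$ suffice: they recover every value of the
      -- form.
      have h := hm (StructuredArrow.mk (FMDual.charEquiv X a))
      rw [key] at h
      replace h := congr_arg (fun g => g.hom x) h
      have h' := FMDual.evalAt_self (FMDual.charEquiv X a) (FMDual.toForm (m.hom x))
      rw [LinearEquiv.symm_apply_apply] at h'
      exact h'.symm.trans h }

variable (R) in
/-- The functor `τ` is the topological dual of the functor of characters. -/
def proToTopIso : proToTop R ≅ FMDual.charDual R :=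
  have : (FMDual.charDual R).IsRightKanExtension (FMDual.charDualCounit R) :=
    (FMDual.charDualIsPointwise R).isRightKanExtension
  Functor.rightKanExtensionUnique _
    ((toFMDual (exactFGProj R)).pointwiseRightKanExtensionCounit (discreteFGProj R)) _
    (FMDual.charDualCounit R)

end Kan

/-! ### Left exactness for split exact sequences -/

section SplitLex

variable {C : Type u} [Category.{v} C] [Preadditive C]

/-- Additive presheaves are left exact for the split exact structure. -/
theorem isLeftExact_of_additive (F : Cᵒᵖ ⥤ AddCommGrpCat.{v}) [F.Additive]
    (S : ShortComplex C) (h : S.Splitting) :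
    Function.Injective (F.map S.g.op) ∧ Function.Exact (F.map S.g.op) (F.map S.f.op) := by
  -- A splitting consists of equations between sums of composites, which an additive functor
  -- preserves.
  have e₁ : F.map S.g.op ≫ F.map h.s.op = 𝟙 _ := by
    rw [← Functor.map_comp, ← op_comp, h.s_g, op_id, CategoryTheory.Functor.map_id]
  have e₂ : F.map S.g.op ≫ F.map S.f.op = 0 := by
    rw [← Functor.map_comp, ← op_comp, S.zero, op_zero, Functor.map_zero]
  have e₃ : F.map S.f.op ≫ F.map h.r.op + F.map h.s.op ≫ F.map S.g.op = 𝟙 _ := by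
    rw [← Functor.map_comp, ← op_comp, ← Functor.map_comp, ← op_comp, ← Functor.map_add, ← op_add,
      h.id, op_id, CategoryTheory.Functor.map_id]
  refine ⟨fun x y hxy => ?_, fun x => ⟨fun hx => ⟨F.map h.s.op x, ?_⟩, ?_⟩⟩
  · have hx := ConcreteCategory.congr_hom e₁ x
    have hy := ConcreteCategory.congr_hom e₁ y
    simp only [ConcreteCategory.comp_apply, ConcreteCategory.id_apply] at hx hy
    rw [← hx, ← hy, hxy]
  · have hx' := ConcreteCategory.congr_hom e₃ x
    change F.map h.r.op (F.map S.f.op x) + F.map S.g.op (F.map h.s.op x) = x at hx'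
    rwa [hx, map_zero, zero_add] at hx'
  · rintro ⟨y, rfl⟩
    exact ConcreteCategory.congr_hom e₂ y

end SplitLex

/-! ### The free presheaf as an admissible Ind-object -/

section FreeInd

variable (R : Type u) [Ring R] (I : Type u)

/-- The presheaf `P ↦ I →₀ P` on the opposite of the category of finitely generated projective
modules, a coproduct of copies of the presheaf represented by the ring. -/
def freePresheaf : (FGProj R)ᵒᵖᵒᵖ ⥤ AddCommGrpCat.{u} where
  obj A := AddCommGrpCat.of (I →₀ A.unop.unop.obj)
  map f := AddCommGrpCat.ofHom
    (Finsupp.mapRange.addMonoidHom f.unop.unop.hom.hom.toAddMonoidHom)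
  map_id A := by
    refine AddCommGrpCat.hom_ext (AddMonoidHom.ext fun (x : I →₀ A.unop.unop.obj) => ?_)
    exact Finsupp.ext fun _ => rfl
  map_comp {A B D} f g := by
    refine AddCommGrpCat.hom_ext (AddMonoidHom.ext fun (x : I →₀ A.unop.unop.obj) => ?_)
    exact Finsupp.ext fun _ => rfl

instance : (freePresheaf R I).Additive where
  map_add {A B f g} := by
    refine AddCommGrpCat.hom_ext (AddMonoidHom.ext fun (x : I →₀ A.unop.unop.obj) => ?_)
    exact Finsupp.ext fun _ => rfl

/-- The finitely generated free module on a finite set of indices. -/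
def FGProj.free {I : Type u} (s : Finset I) : FGProj R :=
  ⟨ModuleCat.of R (s → R), inferInstance, inferInstance⟩

/-- Restriction of functions to smaller sets of indices. -/
def FGProj.restrict {I : Type u} {s t : Finset I} (h : s ⊆ t) :
    FGProj.free R t ⟶ FGProj.free R s :=
  FGProj.ofHom (P := FGProj.free R t) (Q := FGProj.free R s)
    (LinearMap.funLeft R R (Set.inclusion h))

open Classical in
/-- Extension of functions by zero to larger sets of indices, as a linear map. -/
def extendByZero {I : Type u} (s t : Finset I) : (s → R) →ₗ[R] (t → R) where
  toFun x i := if hi : i.1 ∈ s then x ⟨i, hi⟩ else 0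
  map_add' x y := by ext i; by_cases hi : i.1 ∈ s <;> simp [hi]
  map_smul' r x := by ext i; by_cases hi : i.1 ∈ s <;> simp [hi]

/-- Extension of functions by zero to larger sets of indices. -/
def FGProj.extend {I : Type u} (s t : Finset I) : FGProj.free R s ⟶ FGProj.free R t :=
  FGProj.ofHom (P := FGProj.free R s) (Q := FGProj.free R t) (extendByZero R s t)

/-- The kernel is the free module on `t \ s`, and extension by zero splits both maps. In the
opposite category these restrictions become the admissible monics of `freeDiagram`. -/
theorem FGProj.isAdmissibleEpi_restrict {I : Type u} {s t : Finset I} (h : s ⊆ t) :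
    IsAdmissibleEpi (fun S : ShortComplex (FGProj R) => Nonempty S.Splitting)
      (FGProj.restrict R h) := by
  classical
  refine (isAdmissibleEpi_split_iff _).2 ⟨FGProj.free R (t \ s),
    FGProj.extend R _ _, FGProj.restrict R Finset.sdiff_subset,
    FGProj.extend R _ _, ?_, ?_, ?_, ?_⟩
  · refine FGProj.hom_ext fun (x : _ → R) => funext fun i => ?_
    have hi : i.1 ∉ t \ s := fun hi => (Finset.mem_sdiff.1 hi).2 i.2
    exact dif_neg hi
  · exact FGProj.hom_ext fun (x : _ → R) => funext fun i => dif_pos i.2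
  · exact FGProj.hom_ext fun (x : _ → R) => funext fun i => dif_pos i.2
  · refine FGProj.hom_ext fun (x : _ → R) => funext fun i => ?_
    change (dite _ _ _ : R) + (dite _ _ _ : R) = x i
    by_cases hi : i.1 ∈ s
    · rw [dif_neg fun h' => (Finset.mem_sdiff.1 h').2 hi, dif_pos hi, zero_add]
      rfl
    · rw [dif_pos (Finset.mem_sdiff.2 ⟨i.2, hi⟩), dif_neg hi, add_zero]
      rfl

/-- The directed diagram of finitely generated free modules on the finite subsets of `I`. -/
def freeDiagram : Finset I ⥤ (FGProj R)ᵒᵖ where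
  obj s := op (FGProj.free R s)
  map f := (FGProj.restrict R (leOfHom f)).op

variable {R} in
theorem FGProj.elt_add {P : FGProj R} (x y : P.obj) :
    FGProj.elt (x + y) = FGProj.elt x + FGProj.elt y :=
  FGProj.hom_ext fun (r : R) => smul_add r x y

variable {R} in
theorem FGProj.elt_comp {P Q : FGProj R} (x : P.obj) (f : P ⟶ Q) :
    FGProj.elt x ≫ f = FGProj.elt (f.hom.hom x) :=
  FGProj.hom_ext fun (r : R) => f.hom.hom.map_smul r x

variable {R} in
/-- The image of one. -/
def FGProj.evalOne {P : FGProj R} (f : FGProj.self R ⟶ P) : P.obj :=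
  f.hom.hom (1 : R)

variable {R} in
theorem FGProj.elt_evalOne {P : FGProj R} (f : FGProj.self R ⟶ P) :
    FGProj.elt (FGProj.evalOne f) = f := by
  refine FGProj.hom_ext fun (r : R) => ?_
  let g : R →ₗ[R] P.obj := f.hom.hom
  change r • g 1 = g r
  rw [← map_smul, smul_eq_mul, mul_one]

variable {I} in
theorem freePresheaf_map_single {A B : (FGProj R)ᵒᵖᵒᵖ} (f : A ⟶ B) (i : I)
    (x : A.unop.unop.obj) :
    ((freePresheaf R I).map f).hom (Finsupp.single i x) =
      Finsupp.single i (f.unop.unop.hom.hom x) :=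
  Finsupp.mapRange_single (hf := map_zero f.unop.unop.hom.hom)

/-- The morphism from the free presheaf determined by a family of morphisms. -/
def freePresheafDesc {F : (FGProj R)ᵒᵖᵒᵖ ⥤ AddCommGrpCat.{u}}
    (φ : I → (preadditiveYoneda.obj (op (FGProj.self R)) ⟶ F)) : freePresheaf R I ⟶ F where
  app A := AddCommGrpCat.ofHom (Finsupp.liftAddHom fun i =>
    AddMonoidHom.mk' (fun x => (φ i).app A (FGProj.elt (P := A.unop.unop) x).op) fun x y => by
      rw [FGProj.elt_add, op_add]
      exact map_add ((φ i).app A).hom _ _)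
  naturality A B f := by
    refine AddCommGrpCat.hom_ext (Finsupp.addHom_ext fun i (x : A.unop.unop.obj) => ?_)
    have h := ConcreteCategory.congr_hom ((φ i).naturality f) (FGProj.elt (P := A.unop.unop) x).op
    have e : f.unop ≫ (FGProj.elt (P := A.unop.unop) x).op =
        (FGProj.elt (P := B.unop.unop) (f.unop.unop.hom.hom x)).op := by
      rw [← FGProj.elt_comp]
      rfl
    change (φ i).app B (f.unop ≫ (FGProj.elt (P := A.unop.unop) x).op) = _ at h
    rw [e] at h
    change Finsupp.liftAddHom _ (((freePresheaf R I).map f).hom (Finsupp.single i x)) =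
      F.map f (Finsupp.liftAddHom _ (Finsupp.single i x))
    rw [freePresheaf_map_single, Finsupp.liftAddHom_apply_single,
      Finsupp.liftAddHom_apply_single]
    exact h

/-- The inclusion of a summand in the free presheaf. -/
def freePresheafι (i : I) : preadditiveYoneda.obj (op (FGProj.self R)) ⟶ freePresheaf R I where
  app A := AddCommGrpCat.ofHom
    ((Finsupp.singleAddHom i).comp (AddMonoidHom.mk'
      (fun f : A.unop ⟶ op (FGProj.self R) => FGProj.evalOne f.unop) fun _ _ => rfl))
  naturality A B f := by
    refine AddCommGrpCat.hom_ext (AddMonoidHom.ext fun (x : A.unop ⟶ op (FGProj.self R)) => ?_)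
    exact (freePresheaf_map_single R f i (FGProj.evalOne x.unop)).symm

variable {R I}

theorem freePresheafι_desc {F : (FGProj R)ᵒᵖᵒᵖ ⥤ AddCommGrpCat.{u}}
    (φ : I → (preadditiveYoneda.obj (op (FGProj.self R)) ⟶ F)) (i : I) :
    freePresheafι R I i ≫ freePresheafDesc R I φ = φ i := by
  ext A : 2
  refine AddCommGrpCat.hom_ext (AddMonoidHom.ext fun (f : A.unop ⟶ op (FGProj.self R)) => ?_)
  change Finsupp.liftAddHom _ (Finsupp.single i (FGProj.evalOne f.unop)) = _
  rw [Finsupp.liftAddHom_apply_single]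
  change (φ i).app A (FGProj.elt (P := A.unop.unop) (FGProj.evalOne f.unop)).op = _
  rw [FGProj.elt_evalOne]
  rfl

theorem freePresheafι_elt (i : I) (A : (FGProj R)ᵒᵖᵒᵖ) (x : A.unop.unop.obj) :
    ((freePresheafι R I i).app A).hom (FGProj.elt (P := A.unop.unop) x).op = Finsupp.single i x :=
  congr_arg (Finsupp.single i) (one_smul R x)

/-- The group $P^{(I)}$ is generated by the elements `Finsupp.single i x`, and each is the image
under the $i$-th inclusion of the morphism $R\to P$ with $1\mapsto x$. -/
theorem freePresheaf_hom_ext {F : (FGProj R)ᵒᵖᵒᵖ ⥤ AddCommGrpCat.{u}}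
    {f g : freePresheaf R I ⟶ F} (h : ∀ i, freePresheafι R I i ≫ f = freePresheafι R I i ≫ g) :
    f = g := by
  ext A : 2
  refine AddCommGrpCat.hom_ext (Finsupp.addHom_ext fun i (x : A.unop.unop.obj) => ?_)
  have := ConcreteCategory.congr_hom (congr_app (h i) A) (FGProj.elt (P := A.unop.unop) x).op
  rw [← freePresheafι_elt]
  exact this

/-- Evaluation of morphisms from the presheaf represented by the ring, as in the Yoneda lemma. -/
def yonedaSelfEval (F : (FGProj R)ᵒᵖᵒᵖ ⥤ AddCommGrpCat.{u}) :
    (preadditiveYoneda.obj (op (FGProj.self R)) ⟶ F) →+ F.obj (op (op (FGProj.self R))) :=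
  AddMonoidHom.mk' (fun α => (α.app (op (op (FGProj.self R)))).hom (𝟙 (op (FGProj.self R))))
    fun _ _ => rfl

/-- This is the injective half of the Yoneda lemma: by naturality a morphism is determined by its
value at the identity of $R$. -/
theorem yonedaSelfEval_injective (F : (FGProj R)ᵒᵖᵒᵖ ⥤ AddCommGrpCat.{u}) :
    Function.Injective (yonedaSelfEval F) := by
  intro α β h
  ext A : 2
  refine AddCommGrpCat.hom_ext (AddMonoidHom.ext fun (f : A.unop ⟶ op (FGProj.self R)) => ?_)
  have hα := ConcreteCategory.congr_hom (α.naturality f.op) (𝟙 (op (FGProj.self R)))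
  have hβ := ConcreteCategory.congr_hom (β.naturality f.op) (𝟙 (op (FGProj.self R)))
  have e : f ≫ 𝟙 (op (FGProj.self R)) = f := Category.comp_id f
  change α.app A (f ≫ 𝟙 (op (FGProj.self R))) = F.map f.op (yonedaSelfEval F α) at hα
  change β.app A (f ≫ 𝟙 (op (FGProj.self R))) = F.map f.op (yonedaSelfEval F β) at hβ
  rw [e] at hα hβ
  rw [h, ← hβ] at hα
  exact hα

/-- Every morphism from the representable presheaf to the free presheaf is a finite sum of
morphisms to summands. -/
theorem freePresheaf_hom_eq_sum
    (α : preadditiveYoneda.obj (op (FGProj.self R)) ⟶ freePresheaf R I) :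
    ∃ c : I →₀ R, α = ∑ i ∈ c.support,
      preadditiveYoneda.map (FGProj.rightMul (.op (c i))).op ≫ freePresheafι R I i := by
  -- The coefficients are the Yoneda element of `α`, which lies in $R^{(I)}$; its finite support is
  -- why only finitely many summands occur.
  let c : I →₀ R := yonedaSelfEval _ α
  refine ⟨c, yonedaSelfEval_injective _ ?_⟩
  rw [map_sum]
  change c = _
  conv_lhs => rw [← Finsupp.sum_single c]
  refine Finset.sum_congr rfl fun i _ => ?_
  exact congr_arg (Finsupp.single i) (one_mul (c i)).symm

instance {C : Type*} [Category* C] [Preadditive C] :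
    (preadditiveYoneda : C ⥤ _).Additive where
  map_add {X Y f g} := by
    ext A (a : A.unop ⟶ X)
    exact Preadditive.comp_add _ _ _ a f g

variable (R) in
open Classical in
/-- The inclusion of a coordinate in a finitely generated free module; it is zero outside of the
set of indices. -/
def FGProj.freeι (s : Finset I) (i : I) : FGProj.self R ⟶ FGProj.free R s :=
  FGProj.elt (P := FGProj.free R s) fun j => if j.1 = i then (1 : R) else 0

variable (R) in
/-- A coordinate of a finitely generated free module. -/
def FGProj.freeπ {s : Finset I} {i : I} (h : i ∈ s) : FGProj.free R s ⟶ FGProj.self R :=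
  FGProj.form (P := FGProj.free R s) (LinearMap.proj ⟨i, h⟩)

open Classical in
theorem FGProj.freeι_of_notMem {s : Finset I} {i : I} (h : i ∉ s) : FGProj.freeι R s i = 0 :=
  FGProj.hom_ext fun (r : R) => funext fun j => by
    change r * ite _ (1 : R) 0 = 0
    rw [if_neg fun hj => h (Eq.subst (motive := (· ∈ s)) hj j.2), mul_zero]

theorem FGProj.freeι_restrict {s t : Finset I} (h : s ⊆ t) (i : I) :
    FGProj.freeι R t i ≫ FGProj.restrict R h = FGProj.freeι R s i := rfl

theorem FGProj.restrict_freeπ {s t : Finset I} (h : s ⊆ t) {i : I} (hi : i ∈ s) :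
    FGProj.restrict R h ≫ FGProj.freeπ R hi = FGProj.freeπ R (h hi) := rfl

open Classical in
theorem FGProj.freeι_freeπ {s : Finset I} {i : I} (hi : i ∈ s) :
    FGProj.freeι R s i ≫ FGProj.freeπ R hi = 𝟙 _ :=
  FGProj.hom_ext fun (r : R) => by
    change r * ite _ (1 : R) 0 = r
    rw [if_pos rfl, mul_one]

open Classical in
theorem FGProj.sum_freeπ_freeι (s : Finset I) :
    ∑ i : s, FGProj.freeπ R i.2 ≫ FGProj.freeι R s i = 𝟙 _ := by
  refine FGProj.hom_ext fun (x : s → R) => funext fun j => ?_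
  let φ : (FGProj.free R s ⟶ FGProj.free R s) →+ R :=
    AddMonoidHom.mk' (fun f => (f.hom.hom x : s → R) j) fun _ _ => rfl
  change φ _ = x j
  rw [map_sum, Finset.sum_eq_single j]
  · change x j * ite _ (1 : R) 0 = x j
    rw [if_pos rfl, mul_one]
  · intro i _ hi
    change x i * ite _ (1 : R) 0 = 0
    rw [if_neg fun h => hi (Subtype.ext h.symm), mul_zero]
  · exact fun h => absurd (Finset.mem_univ j) h

variable (R) in
/-- The canonical morphism to the free presheaf from the presheaf of a finitely generated free
module. -/
def freeLeg (s : Finset I) :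
    preadditiveYoneda.obj (op (FGProj.free R s)) ⟶ freePresheaf R I :=
  ∑ i ∈ s, preadditiveYoneda.map (FGProj.freeι R s i).op ≫ freePresheafι R I i

theorem restrict_freeLeg {s t : Finset I} (h : s ⊆ t) :
    preadditiveYoneda.map (FGProj.restrict R h).op ≫ freeLeg R t = freeLeg R s := by
  rw [freeLeg, freeLeg, Preadditive.comp_sum]
  simp only [← Category.assoc, ← Functor.map_comp, ← op_comp, FGProj.freeι_restrict]
  refine (Finset.sum_subset h fun i _ hi => ?_).symm
  rw [FGProj.freeι_of_notMem hi, op_zero, Functor.map_zero, zero_comp]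

theorem freeπ_freeLeg (i : I) :
    preadditiveYoneda.map (FGProj.freeπ R (Finset.mem_singleton_self i)).op ≫ freeLeg R {i} =
      freePresheafι R I i := by
  rw [freeLeg, Finset.sum_singleton, ← Category.assoc, ← Functor.map_comp, ← op_comp,
      FGProj.freeι_freeπ, op_id, CategoryTheory.Functor.map_id, Category.id_comp]

/-- Compatibility rewrites the component at each singleton through the component at `s`; what
remains is the decomposition of the identity of $R^s$ into coordinate projections followed by
inclusions. -/
theorem freeLeg_desc {F : (FGProj R)ᵒᵖᵒᵖ ⥤ AddCommGrpCat.{u}}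
    (t : ∀ s : Finset I, preadditiveYoneda.obj (op (FGProj.free R s)) ⟶ F)
    (ht : ∀ {s s' : Finset I} (h : s ⊆ s'),
      preadditiveYoneda.map (FGProj.restrict R h).op ≫ t s' = t s) (s : Finset I) :
    freeLeg R s ≫ freePresheafDesc R I (fun i =>
      preadditiveYoneda.map (FGProj.freeπ R (Finset.mem_singleton_self i)).op ≫ t {i}) = t s := by
  rw [freeLeg, ← Finset.sum_coe_sort, Preadditive.sum_comp]
  have key (i : s) : (preadditiveYoneda.map (FGProj.freeι R s i).op ≫ freePresheafι R I i) ≫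
      freePresheafDesc R I (fun i => preadditiveYoneda.map
        (FGProj.freeπ R (Finset.mem_singleton_self i)).op ≫ t {i}) =
      preadditiveYoneda.map (FGProj.freeπ R i.2 ≫ FGProj.freeι R s i).op ≫ t s := by
    rw [Category.assoc, freePresheafι_desc, ← ht (Finset.singleton_subset_iff.2 i.2),
      ← Category.assoc, ← Category.assoc, ← Functor.map_comp, ← Functor.map_comp, ← op_comp,
      ← op_comp, ← Category.assoc, FGProj.restrict_freeπ]
  rw [Finset.sum_congr rfl fun i _ => key i, ← Preadditive.sum_comp, ← Functor.map_sum,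
    ← op_sum, FGProj.sum_freeπ_freeι, op_id, CategoryTheory.Functor.map_id, Category.id_comp]

variable (R I)

/-- The cocone exhibiting the free presheaf as a colimit of finitely generated free ones. -/
def freeCocone : Cocone (freeDiagram R I ⋙ preadditiveYoneda) where
  pt := freePresheaf R I
  ι :=
    { app := fun s => freeLeg R s
      naturality := fun _ _ f => (restrict_freeLeg (leOfHom f)).trans (Category.comp_id _).symm }

/-- The free presheaf is a colimit of finitely generated free ones. -/
def freeCoconeIsColimit : IsColimit (freeCocone R I) where
  desc t := freePresheafDesc R I fun i =>
    preadditiveYoneda.map (FGProj.freeπ R (Finset.mem_singleton_self i)).op ≫ t.ι.app {i}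
  fac t s := freeLeg_desc (fun s => t.ι.app s) (fun h => t.w (homOfLE h)) s
  uniq t (m : freePresheaf R I ⟶ t.pt) hm := by
    refine freePresheaf_hom_ext fun i => ?_
    have h : freeLeg R {i} ≫ m = t.ι.app {i} := hm {i}
    rw [freePresheafι_desc, ← h, ← Category.assoc, freeπ_freeLeg]

theorem isLeftExact_freePresheaf :
    isLeftExact (splitExactStructure (FGProj R)).opposite (freePresheaf R I) :=
  fun _ ⟨h⟩ => isLeftExact_of_additive _ _ h.op

theorem isAdmissibleInd_freePresheaf :
    isAdmissibleInd (splitExactStructure (FGProj R)).opposite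
      ⟨freePresheaf R I, isLeftExact_freePresheaf R I⟩ :=
  ⟨Finset I, inferInstance, inferInstance, inferInstance, freeDiagram R I, freeCocone R I,
    fun _ _ f => (isAdmissibleMono_op_iff _ _).2 (FGProj.isAdmissibleEpi_restrict R (leOfHom f)),
    ⟨freeCoconeIsColimit R I⟩, ⟨Iso.refl _⟩⟩

end FreeInd

/-! ### Products of copies of the ring and their characters -/

section Product

variable (R : Type u) [Ring R] (I : Type u)

/-- The free presheaf as an admissible Ind-object. -/
def freeInd : IndA (splitExactStructure (FGProj R)).opposite :=
  ⟨⟨freePresheaf R I, isLeftExact_freePresheaf R I⟩, isAdmissibleInd_freePresheaf R I⟩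

/-- The product of copies of the ring, as an admissible Pro-object. -/
def freePro : ProA (splitExactStructure (FGProj R)) := op (freeInd R I)

/-- The projection to a factor. -/
def freeProπ (i : I) :
    freePro R I ⟶ (toProA (splitExactStructure (FGProj R))).obj (FGProj.self R) :=
  Quiver.Hom.op (X := (toIndA (splitExactStructure (FGProj R)).opposite).obj (op (FGProj.self R)))
    (Y := freeInd R I) (ObjectProperty.homMk (ObjectProperty.homMk (freePresheafι R I i)))

variable {R I}

/-- The morphism to a product of copies of the ring determined by its components. -/
def freeProLift {Y : ProA (splitExactStructure (FGProj R))}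
    (φ : I → (Y ⟶ (toProA (splitExactStructure (FGProj R))).obj (FGProj.self R))) :
    Y ⟶ freePro R I :=
  Quiver.Hom.op (X := freeInd R I) (Y := Y.unop) (ObjectProperty.homMk (ObjectProperty.homMk
    (freePresheafDesc R I fun i => (φ i).unop.hom.hom)))

theorem freeProLift_π {Y : ProA (splitExactStructure (FGProj R))}
    (φ : I → (Y ⟶ (toProA (splitExactStructure (FGProj R))).obj (FGProj.self R))) (i : I) :
    freeProLift φ ≫ freeProπ R I i = φ i := by
  apply Quiver.Hom.unop_inj
  apply ObjectProperty.hom_ext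
  apply ObjectProperty.hom_ext
  exact freePresheafι_desc _ i

theorem freePro_hom_ext {Y : ProA (splitExactStructure (FGProj R))} {f g : Y ⟶ freePro R I}
    (h : ∀ i, f ≫ freeProπ R I i = g ≫ freeProπ R I i) : f = g := by
  apply Quiver.Hom.unop_inj
  apply ObjectProperty.hom_ext
  apply ObjectProperty.hom_ext
  exact freePresheaf_hom_ext fun i => congr_arg (fun k => k.unop.hom.hom) (h i)

/-- A morphism in the idempotent completion has to absorb the idempotent of its source; this carries
that condition over from the components to the morphism `FMDual.freeLift`. -/
theorem comp_freeProLift {Y : ProA (splitExactStructure (FGProj R))} {p : Y ⟶ Y}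
    {φ : I → (Y ⟶ (toProA (splitExactStructure (FGProj R))).obj (FGProj.self R))}
    (h : ∀ i, p ≫ φ i = φ i) : p ≫ freeProLift φ = freeProLift φ :=
  freePro_hom_ext fun i => by rw [Category.assoc, freeProLift_π, h]

theorem freePro_hom_self_eq_sum
    (α : freePro R I ⟶ (toProA (splitExactStructure (FGProj R))).obj (FGProj.self R)) :
    ∃ c : I →₀ R, α = ∑ i ∈ c.support,
      freeProπ R I i ≫ (toProA (splitExactStructure (FGProj R))).map
        (FGProj.rightMul (.op (c i))) := by
  obtain ⟨c, hc⟩ := freePresheaf_hom_eq_sum α.unop.hom.hom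
  refine ⟨c, ?_⟩
  let φ : (freePro R I ⟶ (toProA (splitExactStructure (FGProj R))).obj (FGProj.self R)) →+
      (preadditiveYoneda.obj (op (FGProj.self R)) ⟶ freePresheaf R I) :=
    AddMonoidHom.mk' (fun f => f.unop.hom.hom) fun _ _ => rfl
  have hφ : Function.Injective φ := fun f g h => by
    apply Quiver.Hom.unop_inj
    apply ObjectProperty.hom_ext
    apply ObjectProperty.hom_ext
    exact h
  apply hφ
  rw [map_sum]
  exact hc

variable (R I) in
/-- The product of copies of the ring, as a formal dual of a flat Mittag-Leffler module. -/
def FMDual.free : FMDual (splitExactStructure (FGProj R)) :=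
  (Idempotents.toKaroubi _).obj (freePro R I)

variable (R I) in
/-- The projection to a factor. -/
def FMDual.freeπ (i : I) : FMDual.free R I ⟶ FMDual.self R :=
  (Idempotents.toKaroubi _).map (freeProπ R I i)

theorem FMDual.free_hom_ext {Y : FMDual (splitExactStructure (FGProj R))}
    {f g : Y ⟶ FMDual.free R I}
    (h : ∀ i, f ≫ FMDual.freeπ R I i = g ≫ FMDual.freeπ R I i) : f = g :=
  Idempotents.Karoubi.hom_ext _ _
    (freePro_hom_ext fun i => congr_arg Idempotents.Karoubi.Hom.f (h i))

/-- The morphism to a product of copies of the ring determined by its components. -/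
def FMDual.freeLift {Y : FMDual (splitExactStructure (FGProj R))}
    (φ : I → (Y ⟶ FMDual.self R)) : Y ⟶ FMDual.free R I :=
  ⟨freeProLift fun i => (φ i).f, by
    exact (congr_arg (Y.p ≫ ·) (Category.comp_id _)).trans
      (comp_freeProLift fun i => Idempotents.Karoubi.p_comp (φ i))⟩

theorem FMDual.freeLift_π {Y : FMDual (splitExactStructure (FGProj R))}
    (φ : I → (Y ⟶ FMDual.self R)) (i : I) :
    FMDual.freeLift φ ≫ FMDual.freeπ R I i = φ i :=
  Idempotents.Karoubi.hom_ext _ _ (freeProLift_π _ i)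

variable (R I) in
/-- The product of copies of the ring as a fan. -/
def FMDual.freeFan : Fan fun _ : I => FMDual.self R :=
  Fan.mk (FMDual.free R I) (FMDual.freeπ R I)

variable (R I) in
/-- The fan of a product of copies of the ring is a product. -/
def FMDual.freeFanIsLimit : IsLimit (FMDual.freeFan R I) :=
  Fan.IsLimit.mk _ (fun s => FMDual.freeLift s.proj) (fun s i => FMDual.freeLift_π s.proj i)
    fun s _ hm => FMDual.free_hom_ext fun i => (hm i).trans (FMDual.freeLift_π s.proj i).symm

/-- Morphisms from a product of copies of the ring to the ring factor through finitely many
factors. -/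
theorem FMDual.span_freeπ : Submodule.span Rᵐᵒᵖ (Set.range (FMDual.freeπ R I)) = ⊤ := by
  refine eq_top_iff.2 fun α _ => ?_
  obtain ⟨c, hc⟩ := freePro_hom_self_eq_sum α.f
  have h : α = ∑ i ∈ c.support, MulOpposite.op (c i) • FMDual.freeπ R I i := by
    let φ : (FMDual.free R I ⟶ FMDual.self R) →+
        (freePro R I ⟶ (toProA (splitExactStructure (FGProj R))).obj (FGProj.self R)) :=
      AddMonoidHom.mk' (fun f => f.f) fun _ _ => rfl
    have hφ : Function.Injective φ := fun f g h => Idempotents.Karoubi.hom_ext _ _ h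
    apply hφ
    rw [map_sum]
    exact hc
  rw [h]
  exact Submodule.sum_mem _ fun i _ => Submodule.smul_mem _ _ (Submodule.subset_span ⟨i, rfl⟩)

theorem FMDual.smul_id_eq_zero {r : Rᵐᵒᵖ} (h : r • 𝟙 (FMDual.self R) = 0) : r = 0 := by
  rw [FMDual.smul_def, Category.id_comp, Functor.map_eq_zero_iff] at h
  have h' := congr_arg (FGProj.evalOne (R := R)) h
  change 1 * r.unop = 0 at h'
  rwa [one_mul, MulOpposite.unop_eq_zero_iff] at h'

/-- Precomposing a relation with the $i$-th coordinate inclusion $R\to R^I$ kills every projection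
except the $i$-th, which becomes the identity, and so isolates the $i$-th coefficient. -/
theorem FMDual.linearIndependent_freeπ : LinearIndependent Rᵐᵒᵖ (FMDual.freeπ R I) := by
  classical
  refine linearIndependent_iff.2 fun l hl => Finsupp.ext fun i => FMDual.smul_id_eq_zero ?_
  have h := congr_arg (FMDual.precomp (FMDual.freeLift fun j => if i = j then 𝟙 _ else 0)) hl
  rw [map_zero, Finsupp.apply_linearCombination] at h
  rw [← h, Finsupp.linearCombination_apply, Finsupp.sum_eq_single i]
  · change _ = l i • (_ ≫ _)
    rw [FMDual.freeLift_π, if_pos rfl]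
  · intro j _ hj
    change l j • (_ ≫ _) = 0
    rw [FMDual.freeLift_π, if_neg hj.symm, smul_zero]
  · exact fun _ => zero_smul _ _

variable (R I) in
/-- The projections to the factors are a basis of the module of characters of a product of copies
of the ring. -/
def FMDual.freeBasis : Module.Basis I Rᵐᵒᵖ (FMDual.free R I ⟶ FMDual.self R) :=
  .mk FMDual.linearIndependent_freeπ FMDual.span_freeπ.ge

end Product

/-! ### Duality between retracts of products and projective right modules -/

section Duality

variable {R : Type u} [Ring R]

theorem FGProj.sum_coord_gen (P : FGProj R) :
    ∑ k, FGProj.form (P.coord k) ≫ FGProj.elt (P.gen k) = 𝟙 P := by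
  refine FGProj.hom_ext fun x => ?_
  let φ : (P ⟶ P) →+ P.obj := AddMonoidHom.mk' (fun f => f.hom.hom x) fun _ _ => rfl
  change φ _ = x
  rw [map_sum]
  exact P.sum_coord_smul_gen x

/-- A dual basis makes each factor $M_k$ a retract of $R^{n_k}$, and a product of retractions is a
retraction. The index set therefore has one element for each coordinate form of each factor. -/
theorem FMDual.exists_retract_of_isLimit {K : Type u} {M : K → FGProj R}
    (c : Fan fun k => (toFMDual (splitExactStructure (FGProj R))).obj (M k)) (hc : IsLimit c) :
    ∃ (I : Type u) (i : c.pt ⟶ FMDual.free R I) (p : FMDual.free R I ⟶ c.pt), i ≫ p = 𝟙 _ := by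
  let J := toFMDual (splitExactStructure (FGProj R))
  let I : Type u := Σ k, Fin (M k).rank
  let i : c.pt ⟶ FMDual.free R I :=
    FMDual.freeLift fun j => c.proj j.1 ≫ J.map (FGProj.form ((M j.1).coord j.2))
  let p : FMDual.free R I ⟶ c.pt := Fan.IsLimit.lift hc fun k =>
    ∑ n, FMDual.freeπ R I ⟨k, n⟩ ≫ J.map (FGProj.elt ((M k).gen n))
  refine ⟨I, i, p, Fan.IsLimit.hom_ext hc _ _ fun k => ?_⟩
  rw [Category.assoc, Fan.IsLimit.fac, Preadditive.comp_sum, Category.id_comp]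
  simp only [i]
  have h (n : Fin (M k).rank) : FMDual.freeLift (I := I) (fun j => c.proj j.1 ≫
      J.map (FGProj.form ((M j.1).coord j.2))) ≫ FMDual.freeπ R I ⟨k, n⟩ ≫
        J.map (FGProj.elt ((M k).gen n)) =
      c.proj k ≫ J.map (FGProj.form ((M k).coord n) ≫ FGProj.elt ((M k).gen n)) := by
    rw [← Category.assoc, FMDual.freeLift_π, Category.assoc, Functor.map_comp]
  rw [Finset.sum_congr rfl fun n _ => h n, ← Preadditive.comp_sum, ← Functor.map_sum,
    FGProj.sum_coord_gen, CategoryTheory.Functor.map_id]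
  exact Category.comp_id _

theorem FMDual.exists_retract {X : FMDual (splitExactStructure (FGProj R))}
    (hX : isFormalDualOfProjective _ X) :
    ∃ (I : Type u) (i : X ⟶ FMDual.free R I) (p : FMDual.free R I ⟶ X), i ≫ p = 𝟙 _ := by
  obtain ⟨K, M, c, ⟨hc⟩, Y, b, ⟨hb⟩, ⟨e⟩⟩ := hX
  obtain ⟨I, i, p, h⟩ := FMDual.exists_retract_of_isLimit c hc
  refine ⟨I, b.inl ≫ e.hom ≫ i, p ≫ e.inv ≫ b.fst, ?_⟩
  simp only [Category.assoc]
  rw [reassoc_of% h, Iso.hom_inv_id_assoc, b.inl_fst]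

theorem FMDual.projective_char {X : FMDual (splitExactStructure (FGProj R))}
    (hX : isFormalDualOfProjective _ X) : Module.Projective Rᵐᵒᵖ (FMDual.Char X) := by
  obtain ⟨I, i, p, h⟩ := FMDual.exists_retract hX
  have : Module.Projective Rᵐᵒᵖ (FMDual.free R I ⟶ FMDual.self R) :=
    .of_basis (FMDual.freeBasis R I)
  have : Module.Projective Rᵐᵒᵖ (X ⟶ FMDual.self R) :=
    .of_split (FMDual.precomp p) (FMDual.precomp i) (LinearMap.ext fun a => by
      change i ≫ p ≫ a = a
      rw [reassoc_of% h])
  exact .of_equiv (FMDual.charEquiv X).symm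

/-- After embedding $Y$ in some $R^I$, morphisms are detected by the projections, which restrict to
characters of $Y$. This gives faithfulness of the character functor. -/
theorem FMDual.eq_of_precomp_eq {X Y : FMDual (splitExactStructure (FGProj R))}
    (hY : isFormalDualOfProjective _ Y) {f g : X ⟶ Y}
    (h : FMDual.precomp f = FMDual.precomp g) : f = g := by
  obtain ⟨I, i, p, hip⟩ := FMDual.exists_retract hY
  rw [← Category.comp_id f, ← Category.comp_id g, ← hip, ← Category.assoc, ← Category.assoc]
  congr 1
  refine FMDual.free_hom_ext fun j => ?_
  rw [Category.assoc, Category.assoc]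
  exact LinearMap.congr_fun h (i ≫ FMDual.freeπ R I j)

/-- If $Y=R^I$, the images under $h$ of the projections are the components of the desired morphism,
since the projections form a basis of the characters. In general this is applied to the composite of
$h$ with restriction along $i\colon Y\to R^I$, and the result is followed by the retraction $p$.
This gives fullness. -/
theorem FMDual.exists_precomp_eq {X Y : FMDual (splitExactStructure (FGProj R))}
    (hY : isFormalDualOfProjective _ Y)
    (h : (Y ⟶ FMDual.self R) →ₗ[Rᵐᵒᵖ] (X ⟶ FMDual.self R)) :
    ∃ f : X ⟶ Y, FMDual.precomp f = h := by
  obtain ⟨I, i, p, hip⟩ := FMDual.exists_retract hY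
  let l : X ⟶ FMDual.free R I := FMDual.freeLift fun j => h (i ≫ FMDual.freeπ R I j)
  have hl : FMDual.precomp l = h ∘ₗ FMDual.precomp i := by
    refine (FMDual.freeBasis R I).ext fun j => ?_
    simp only [FMDual.freeBasis, Module.Basis.coe_mk]
    exact FMDual.freeLift_π _ j
  refine ⟨l ≫ p, LinearMap.ext fun a => ?_⟩
  have := LinearMap.congr_fun hl (p ≫ a)
  change l ≫ p ≫ a = h (i ≫ p ≫ a) at this
  rw [reassoc_of% hip] at this
  rw [← this]
  exact Category.assoc l p a

/-- The complement is obtained by splitting the idempotent `𝟙 W - p ≫ i`, which is possible in an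
idempotent completion. -/
theorem FMDual.isDirectSummand_of_retract {X W : FMDual (splitExactStructure (FGProj R))}
    (i : X ⟶ W) (p : W ⟶ X) (h : i ≫ p = 𝟙 _) : IsDirectSummand X W := by
  have hid : (𝟙 W - p ≫ i) ≫ (𝟙 W - p ≫ i) = 𝟙 W - p ≫ i := by
    simp [Preadditive.sub_comp, Preadditive.comp_sub, reassoc_of% h]
  obtain ⟨Y, j, q, hjq, hqj⟩ := IsIdempotentComplete.idempotents_split W _ hid
  have e₁ : i ≫ q = 0 := by
    have : i ≫ (q ≫ j) ≫ q = 0 := by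
      rw [hqj, Preadditive.sub_comp, Category.id_comp, Preadditive.comp_sub, Category.assoc,
        reassoc_of% h, sub_self]
    rwa [Category.assoc, hjq, Category.comp_id] at this
  have e₂ : j ≫ p = 0 := by
    have : j ≫ (q ≫ j) ≫ p = 0 := by
      rw [hqj, Preadditive.sub_comp, Category.id_comp, Preadditive.comp_sub, Category.assoc, h,
        Category.comp_id, sub_self]
    rwa [Category.assoc, reassoc_of% hjq] at this
  let b : BinaryBicone X Y :=
    { pt := W, fst := p, snd := q, inl := i, inr := j, inl_fst := h, inl_snd := e₁,
      inr_fst := e₂, inr_snd := hjq }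
  refine ⟨Y, b, ⟨isBinaryBilimitOfTotal b ?_⟩, ⟨Iso.refl _⟩⟩
  change p ≫ i + q ≫ j = 𝟙 _
  rw [hqj, add_sub_cancel]

theorem FMDual.isFormalDualOfProjective_free (I : Type u) :
    isFormalDualOfProjective _ (FMDual.free R I) :=
  ⟨I, fun _ => FGProj.self R, FMDual.freeFan R I, ⟨FMDual.freeFanIsLimit R I⟩,
    FMDual.isDirectSummand_of_retract (𝟙 _) (𝟙 _) (Category.id_comp _)⟩

theorem FMDual.isFormalDualOfProjective_of_retract {I : Type u}
    {X : FMDual (splitExactStructure (FGProj R))}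
    (i : X ⟶ FMDual.free R I) (p : FMDual.free R I ⟶ X) (h : i ≫ p = 𝟙 _) :
    isFormalDualOfProjective _ X :=
  ⟨I, fun _ => FGProj.self R, FMDual.freeFan R I, ⟨FMDual.freeFanIsLimit R I⟩,
    FMDual.isDirectSummand_of_retract i p h⟩

/-- A projective $M$ is the image of an idempotent on the free module with index set $M$ itself.
Full faithfulness lifts that idempotent to the product $R^M$, where it splits; the characters of the
resulting summand are $M$. -/
theorem FMDual.exists_char_equiv (M : Type u) [AddCommGroup M] [Module Rᵐᵒᵖ M]
    [Module.Projective Rᵐᵒᵖ M] : ∃ X : FMDual (splitExactStructure (FGProj R)),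
      isFormalDualOfProjective _ X ∧ Nonempty ((X ⟶ FMDual.self R) ≃ₗ[Rᵐᵒᵖ] M) := by
  obtain ⟨s, hs⟩ := Module.projective_def'.1 ‹Module.Projective Rᵐᵒᵖ M›
  let B := FMDual.freeBasis R M
  let σ : M →ₗ[Rᵐᵒᵖ] (FMDual.free R M ⟶ FMDual.self R) := B.repr.symm.toLinearMap ∘ₗ s
  let π : (FMDual.free R M ⟶ FMDual.self R) →ₗ[Rᵐᵒᵖ] M :=
    Finsupp.linearCombination Rᵐᵒᵖ id ∘ₗ B.repr.toLinearMap
  have hπσ : π ∘ₗ σ = LinearMap.id := by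
    ext m
    have := LinearMap.congr_fun hs m
    simpa [π, σ] using this
  have hW := FMDual.isFormalDualOfProjective_free (R := R) M
  obtain ⟨e, he⟩ := FMDual.exists_precomp_eq hW (σ ∘ₗ π)
  have he' (a) : e ≫ a = σ (π a) := LinearMap.congr_fun he a
  have hπσ' (m) : π (σ m) = m := LinearMap.congr_fun hπσ m
  have hid : e ≫ e = e := by
    -- Idempotency may be checked on characters, where `e` acts as `σ ∘ₗ π` and `π ∘ₗ σ` is the
    -- identity.
    refine FMDual.eq_of_precomp_eq hW (LinearMap.ext fun a => ?_)
    change (e ≫ e) ≫ a = e ≫ a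
    rw [Category.assoc, he' a, he', hπσ']
  obtain ⟨X, i, p, hip, hpi⟩ := IsIdempotentComplete.idempotents_split _ e hid
  refine ⟨X, FMDual.isFormalDualOfProjective_of_retract i p hip, ⟨LinearEquiv.ofLinearMap
    (π ∘ₗ FMDual.precomp p) (FMDual.precomp i ∘ₗ σ) (LinearMap.ext fun m => ?_)
    (LinearMap.ext fun a => ?_)⟩⟩
  · change π (p ≫ i ≫ σ m) = m
    rw [reassoc_of% hpi, he', hπσ', hπσ']
  · change i ≫ σ (π (p ≫ a)) = a
    rw [← he', ← hpi, Category.assoc, reassoc_of% hip, reassoc_of% hip]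

end Duality

/-! ### Reflexivity of projective modules -/

section Reflexivity

variable {R : Type u} [Ring R] [TopologicalSpace R] [DiscreteTopology R]

section

variable {N : Type u} [AddCommGroup N] [Module Rᵐᵒᵖ N]

/-- The linear forms attached to a section of the canonical presentation of a module. -/
def coordForm (s : N →ₗ[Rᵐᵒᵖ] N →₀ Rᵐᵒᵖ) (b : N) : N →ₗ[Rᵐᵒᵖ] R where
  toFun n := (s n b).unop
  map_add' m n := by simp
  map_smul' r n := by simp

variable [TopologicalSpace N]

/-- Evaluation of elements of the topological dual. -/
def TopDual.eval (m : N) : TopDual (R := R) N →ₗ[R] R where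
  toFun f := (show N →L[Rᵐᵒᵖ] R from f) m
  map_add' _ _ := rfl
  map_smul' _ _ := rfl

/-- The linear form underlying an element of the topological dual. -/
def TopDual.toForm (f : TopDual (R := R) N) : N →ₗ[Rᵐᵒᵖ] R :=
  (show N →L[Rᵐᵒᵖ] R from f).toLinearMap

theorem TopDual.eval_eq_toForm (n : N) (f : TopDual (R := R) N) :
    TopDual.eval n f = TopDual.toForm f n := rfl

theorem TopDual.ext_eval {f g : TopDual (R := R) N} (h : ∀ n, TopDual.eval n f = TopDual.eval n g) :
    f = g :=
  ContinuousLinearMap.ext (M₁ := N) (M₂ := R) h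

variable [DiscreteTopology N]

/-- A linear form on a discrete module as an element of the topological dual. -/
def TopDual.ofForm (l : N →ₗ[Rᵐᵒᵖ] R) : TopDual (R := R) N :=
  show N →L[Rᵐᵒᵖ] R from ⟨l, continuous_of_discreteTopology⟩

/-- A continuous linear form on the topological dual of a discrete module vanishes on the
annihilator of a finite set. -/
theorem TopDual.exists_finset_eval {φ : TopDual (R := R) N →ₗ[R] R} (hφ : Continuous φ) :
    ∃ s : Finset N, ∀ f : TopDual (R := R) N, (∀ n ∈ s, TopDual.eval n f = 0) → φ f = 0 := by
  have hi : Topology.IsInducing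
      (fun (f : TopDual (R := R) N) (n : N) => TopDual.eval n f) :=
    (ContinuousMap.isHomeomorph_coe.isEmbedding.isInducing).comp
      (Topology.IsInducing.mk (f := TopDual.toContinuousMap (R := R) N) rfl)
  -- As $R$ is discrete, the kernel of `φ` is open, so it contains a basic neighbourhood of zero for
  -- pointwise convergence, which constrains only finitely many values.
  have h0 : φ ⁻¹' {0} ∈ nhds (0 : TopDual (R := R) N) :=
    ((isOpen_discrete _).preimage hφ).mem_nhds (map_zero φ)
  rw [hi.nhds_eq_comap, nhds_pi, Filter.mem_comap] at h0
  obtain ⟨t, ht, hsub⟩ := h0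
  obtain ⟨s, hs, u, hu, hut⟩ := Filter.mem_pi.1 ht
  refine ⟨hs.toFinset, fun f hf => hsub (hut fun n hn => ?_)⟩
  have h : TopDual.eval n f = TopDual.eval n (0 : TopDual (R := R) N) :=
    hf n (hs.mem_toFinset.2 hn)
  change TopDual.eval n f ∈ u n
  rw [h]
  exact mem_of_mem_nhds (hu n)

variable [Module.Projective Rᵐᵒᵖ N]

/-- The coordinate forms of a section of $N^{(R)}\to N$ type presentations, here the one with index
set $N$, are continuous and separate the elements of $N$. -/
theorem TopDual.eval_injective : Function.Injective (TopDual.eval (R := R) (N := N)) := by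
  obtain ⟨s, hs⟩ := Module.projective_def'.1 ‹Module.Projective Rᵐᵒᵖ N›
  intro m n h
  have h' : s m = s n := by
    ext b
    apply MulOpposite.unop_injective
    exact LinearMap.congr_fun h (TopDual.ofForm (coordForm s b))
  rw [← LinearMap.id_apply (R := Rᵐᵒᵖ) m, ← LinearMap.id_apply (R := Rᵐᵒᵖ) n, ← hs,
    LinearMap.comp_apply, LinearMap.comp_apply, h']

/-- Projective modules are reflexive. -/
theorem TopDual.exists_eq_eval {φ : TopDual (R := R) N →ₗ[R] R} (hφ : Continuous φ) :
    ∃ n : N, φ = TopDual.eval n := by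
  classical
  obtain ⟨s, hs⟩ := Module.projective_def'.1 ‹Module.Projective Rᵐᵒᵖ N›
  obtain ⟨t, ht⟩ := TopDual.exists_finset_eval hφ
  -- These are the finitely many basis indices needed to expand the elements of `t`.
  let u : Finset N := t.biUnion fun n => (s n).support
  let l := coordForm s
  refine ⟨∑ b ∈ u, MulOpposite.op (φ (TopDual.ofForm (l b))) • b, LinearMap.ext fun f => ?_⟩
  -- On `t` the form `f` agrees with $\sum_b f(b)\,l_b$, so `φ` does not distinguish them. Hence
  -- $\varphi(f)=\sum_b f(b)\varphi(l_b)$, which is the value of `f` at $\sum_b b\,\varphi(l_b)$.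
  have key : φ (f - ∑ b ∈ u, TopDual.eval b f • TopDual.ofForm (l b)) = 0 := by
    refine ht _ fun n hn => ?_
    have hsn : ∑ b ∈ u, s n b • b = n := by
      have := LinearMap.congr_fun hs n
      rw [LinearMap.comp_apply, Finsupp.linearCombination_apply, LinearMap.id_apply,
        Finsupp.sum_of_support_subset _ (Finset.subset_biUnion_of_mem (fun n => (s n).support) hn)
          _ (by simp)] at this
      exact this
    rw [map_sub, map_sum, sub_eq_zero, TopDual.eval_eq_toForm]
    conv_lhs => rw [← hsn, map_sum]
    refine Finset.sum_congr rfl fun b _ => ?_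
    rw [map_smul, map_smul]
    rfl
  rw [map_sub, map_sum, sub_eq_zero] at key
  rw [key, TopDual.eval_eq_toForm, map_sum]
  refine Finset.sum_congr rfl fun b _ => ?_
  rw [map_smul, map_smul]
  rfl

end

theorem TopDual.eval_projTopDual_map {M N : (ProjMod Rᵐᵒᵖ)ᵒᵖ} (f : M ⟶ N)
    (g : (projTopDual R).obj M) (n : N.unop.obj) :
    letI : TopologicalSpace N.unop.obj := ⊥
    letI : TopologicalSpace M.unop.obj := ⊥
    TopDual.eval (N := N.unop.obj) n (((projTopDual R).map f).hom g) =
      TopDual.eval (N := M.unop.obj) (f.unop.hom.hom n) g := rfl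

instance : (projTopDual R).Faithful where
  map_injective {M N f g} h := by
    let : TopologicalSpace M.unop.obj := ⊥
    have : DiscreteTopology M.unop.obj := ⟨rfl⟩
    have : Module.Projective Rᵐᵒᵖ M.unop.obj := M.unop.property
    apply Quiver.Hom.unop_inj
    apply ObjectProperty.hom_ext
    refine ModuleCat.hom_ext (LinearMap.ext fun n => ?_)
    refine TopDual.eval_injective (R := R) (N := M.unop.obj) (LinearMap.ext fun x => ?_)
    refine (TopDual.eval_projTopDual_map f x n).symm.trans ?_
    rw [h]
    exact TopDual.eval_projTopDual_map g x n

/-- Composing a continuous map $M^\vee\to N^\vee$ with evaluation at $n$ gives a continuous form on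
$M^\vee$, hence evaluation at some $g(n)\in M$. Injectivity of evaluation makes $g$ linear. -/
instance : (projTopDual R).Full where
  map_surjective {M N} φ := by
    let : TopologicalSpace M.unop.obj := ⊥
    have : DiscreteTopology M.unop.obj := ⟨rfl⟩
    have : Module.Projective Rᵐᵒᵖ M.unop.obj := M.unop.property
    let : TopologicalSpace N.unop.obj := ⊥
    let ψ : TopDual (R := R) M.unop.obj →L[R] TopDual (R := R) N.unop.obj := φ.hom
    have h (n : N.unop.obj) : ∃ m : M.unop.obj,
        TopDual.eval (R := R) n ∘ₗ ψ.toLinearMap = TopDual.eval m :=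
      TopDual.exists_eq_eval ((TopDual.continuous_eval n).comp ψ.continuous)
    choose g hg using h
    have hg' (n : N.unop.obj) (x : TopDual (R := R) M.unop.obj) :
        TopDual.toForm (ψ x) n = TopDual.toForm x (g n) := LinearMap.congr_fun (hg n) x
    let l : N.unop.obj →ₗ[Rᵐᵒᵖ] M.unop.obj :=
      { toFun := g
        map_add' := fun m n => TopDual.eval_injective (R := R) (LinearMap.ext fun x => by
          rw [TopDual.eval_eq_toForm, TopDual.eval_eq_toForm, ← hg', map_add, map_add, hg', hg'])
        map_smul' := fun r n => TopDual.eval_injective (R := R) (LinearMap.ext fun x => by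
          rw [TopDual.eval_eq_toForm, TopDual.eval_eq_toForm, ← hg', map_smul, map_smul, hg']
          rfl) }
    refine ⟨Quiver.Hom.op (ObjectProperty.homMk (ModuleCat.ofHom l)), ?_⟩
    refine ConcreteCategory.ext (ContinuousLinearMap.ext fun x => ?_)
    exact TopDual.ext_eval (N := N.unop.obj) fun n => (hg' n x).symm

end Reflexivity

/-! ### The character equivalence and the conclusion -/

section Main

variable (R : Type u) [Ring R] [TopologicalSpace R] [DiscreteTopology R]

/-- The functor sending a formal dual of a projective module to its module of characters. -/
def PDual.charFunctor : PDual (exactFGProj R) ⥤ (ProjMod Rᵐᵒᵖ)ᵒᵖ where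
  obj X := op ⟨ModuleCat.of Rᵐᵒᵖ (FMDual.Char X.obj), FMDual.projective_char X.property⟩
  map {X Y} f := Quiver.Hom.op (ObjectProperty.homMk ((FMDual.charFunctor R).map f.hom).unop)
  map_id X := by
    apply Quiver.Hom.unop_inj
    apply ObjectProperty.hom_ext
    exact congr_arg Quiver.Hom.unop ((FMDual.charFunctor R).map_id X.obj)
  map_comp f g := by
    apply Quiver.Hom.unop_inj
    apply ObjectProperty.hom_ext
    exact congr_arg Quiver.Hom.unop ((FMDual.charFunctor R).map_comp f.hom g.hom)

instance : (PDual.charFunctor R).Faithful where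
  map_injective {X Y f g} h := by
    apply ObjectProperty.hom_ext
    refine FMDual.eq_of_precomp_eq Y.property (LinearMap.ext fun a => ?_)
    have h' := congr_arg (fun k => FMDual.charEquiv X.obj
      (k.unop.hom.hom ((FMDual.charEquiv Y.obj).symm a))) h
    change FMDual.charEquiv X.obj (((FMDual.charFunctor R).map f.hom).unop.hom _) =
      FMDual.charEquiv X.obj (((FMDual.charFunctor R).map g.hom).unop.hom _) at h'
    rw [FMDual.charFunctor_map_symm, FMDual.charFunctor_map_symm] at h'
    rw [LinearEquiv.apply_symm_apply, LinearEquiv.apply_symm_apply] at h'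
    exact h'

instance : (PDual.charFunctor R).Full where
  map_surjective {X Y} φ := by
    obtain ⟨f, hf⟩ := FMDual.exists_precomp_eq Y.property
      ((FMDual.charEquiv X.obj).toLinearMap ∘ₗ φ.unop.hom.hom ∘ₗ
        (FMDual.charEquiv Y.obj).symm.toLinearMap)
    refine ⟨ObjectProperty.homMk f, ?_⟩
    apply Quiver.Hom.unop_inj
    apply ObjectProperty.hom_ext
    refine ModuleCat.hom_ext (LinearMap.ext fun (a : FMDual.Char Y.obj) => ?_)
    apply (FMDual.charEquiv X.obj).injective
    refine (FMDual.charEquiv_charFunctor_map f a).trans ?_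
    have := LinearMap.congr_fun hf (FMDual.charEquiv Y.obj a)
    refine this.trans (congr_arg (fun b => FMDual.charEquiv X.obj (φ.unop.hom.hom b)) ?_)
    exact (FMDual.charEquiv Y.obj).symm_apply_apply a

instance : (PDual.charFunctor R).EssSurj where
  mem_essImage M := by
    have : Module.Projective Rᵐᵒᵖ M.unop.obj := M.unop.property
    obtain ⟨X, hX, ⟨e⟩⟩ := FMDual.exists_char_equiv (R := R) M.unop.obj
    exact ⟨⟨X, hX⟩, ⟨Iso.op ((isProjectiveModule Rᵐᵒᵖ).isoMk
      ((FMDual.charEquiv X).trans e).toModuleIso).symm⟩⟩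

instance : (PDual.charFunctor R).IsEquivalence where

/-- The functor `τ` on formal duals of projective modules. -/
def PDual.proToTopIso : PDual.toFMDual (exactFGProj R) ⋙ proToTop R ≅
    PDual.charFunctor R ⋙ projTopDual R :=
  Functor.isoWhiskerLeft _ (_root_.proToTopIso R) ≪≫ Iso.refl _

end Main

end

theorem corollary4 (R : Type u) [Ring R] [TopologicalSpace R] [DiscreteTopology R] :
    (PDual.toFMDual (exactFGProj R) ⋙ proToTop R).Full ∧
    (PDual.toFMDual (exactFGProj R) ⋙ proToTop R).Faithful ∧
    ∃ D : (ProjMod Rᵐᵒᵖ)ᵒᵖ ⥤ PDual (exactFGProj R),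
      D.IsEquivalence ∧
      Nonempty (D ⋙ PDual.toFMDual (exactFGProj R) ⋙ proToTop R ≅ projTopDual R) ∧
      (D ⋙ PDual.toFMDual (exactFGProj R)).Full ∧
      (D ⋙ PDual.toFMDual (exactFGProj R)).Faithful := by
  -- Full faithfulness is transported from the composite of the character equivalence with the
  -- topological dual; $D$ is the inverse of that equivalence.
  refine ⟨.of_iso (PDual.proToTopIso R).symm, .of_iso (PDual.proToTopIso R).symm,
    (PDual.charFunctor R).inv, inferInstance, ⟨?_⟩, inferInstance, inferInstance⟩
  exact Functor.isoWhiskerLeft _ (PDual.proToTopIso R) ≪≫ (Functor.associator _ _ _).symm ≪≫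
    Functor.isoWhiskerRight (PDual.charFunctor R).asEquivalence.counitIso _ ≪≫
    Functor.leftUnitor _
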